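/- Let $E$ be a complex Banach space with Banach dual $E'$, let $\mathcal B(E)$ be the algebra of bounded linear operators on $E$, and let $\mathcal A$ be a standard operator algebra on $E$, that is, a (not necessarily unital or closed) subalgebra of $\mathcal B(E)$ containing all bounded finite rank operators. For $T\in\mathcal B(E)$ let $T':E'\to E'$, $f\mapsto f\circ T$, be its dual operator. Fix $k\ge 2$ and a finite sequence $(i_1,\dots,i_m)$ with $\{i_1,\dots,i_m\}=\{1,\dots,k\}$ in which some index $i_p$ is different from all the other indices $i_q$ $(q\neq p)$. For $T_1,\dots,T_k\in\mathcal A$ define the generalized product and the generalized Jordan product $$T_1*\cdots*T_k=T_{i_1}\cdots T_{i_m},\qquad T_1\circ\cdots\circ T_k=T_{i_1}\cdots T_{i_m}+T_{i_m}\cdots T_{i_1}.$$ An algebra automorphism of $\mathcal A$ is a linear bijection $\theta:\mathcal A\to\mathcal A$ with $\theta(ab)=\theta(a)\theta(b)$ for all $a,b\in\mathcal A$; a linear Jordan automorphism of $\mathcal A$ is a linear bijection $\theta:\mathcal A\to\mathcal A$ with $\theta(ab+ba)=\theta(a)\theta(b)+\theta(b)\theta(a)$ for all $a,b\in\mathcal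 A$. **Theorem.** Let $\phi:\mathcal A\to\mathcal A$ be a map (not necessarily linear, additive or continuous), and suppose that one of the following holds. (a) The range $\phi(\mathcal A)$ contains all bounded operators on $E$ of rank at most two, and for any $a_1,\dots,a_k\in\mathcal A$, at least one of which has rank at most one, there is an algebra automorphism $\theta_{a_1,\dots,a_k}$ of $\mathcal A$ such that $$\phi(a_1)*\cdots*\phi(a_k)=\theta_{a_1,\dots,a_k}(a_1*\cdots*a_k).$$ (b) The range $\phi(\mathcal A)$ contains all bounded operators on $E$ of rank at most three, and for any $a_1,\dots,a_k\in\mathcal A$, at least one of which has rank at most one, there is a linear Jordan automorphism $\theta_{a_1,\dots,a_k}$ of $\mathcal A$ such that $$\phi(a_1)\circ\cdots\circ\phi(a_k)=\theta_{a_1,\dots,a_k}(a_1\circ\cdots\circ a_k).$$ Then there is a complex scalar $\xi$ with $\xi^m=1$ such that either $\phi(A)=\xi SAS^{-1}$ for all $A\in\mathcal A$, for some invertible bounded linear operator $S:E\to E$, or $\phi(A)=\xi SA'S^{-1}$ for all $A\in\mathcal A$, for some invertible bounded linear operator $S:E'\to E$. -/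

import Mathlib

namespace OpProd

section

variable {E : Type*} [NormedAddCommGroup E] [NormedSpace ℂ E]

/-- A standard operator algebra on `E`: a (not necessarily unital or closed) subalgebra of the
algebra `E →L[ℂ] E` of bounded operators that contains every bounded operator of finite rank. -/
def IsStandard (A : NonUnitalSubalgebra ℂ (E →L[ℂ] E)) : Prop :=
  ∀ T : E →L[ℂ] E, FiniteDimensional ℂ (LinearMap.range (T : E →ₗ[ℂ] E)) → T ∈ A

/-- `T` has rank at most `r`. -/
def RankLE (r : ℕ) (T : E →L[ℂ] E) : Prop :=
  LinearMap.rank (T : E →ₗ[ℂ] E) ≤ (r : Cardinal)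

/-- The Banach dual `T' : E' → E'` of a bounded operator, `f ↦ f ∘ T`. -/
noncomputable def dualOp (T : E →L[ℂ] E) : StrongDual ℂ E →L[ℂ] StrongDual ℂ E :=
  ContinuousLinearMap.precomp ℂ T

theorem dualOp_apply (T : E →L[ℂ] E) (f : StrongDual ℂ E) (x : E) : dualOp T f x = f (T x) :=
  rfl

/-- An algebra automorphism: a linear bijection that is multiplicative. -/
def IsAlgAut {A : NonUnitalSubalgebra ℂ (E →L[ℂ] E)} (θ : A ≃ₗ[ℂ] A) : Prop :=
  ∀ x y : A, θ (x * y) = θ x * θ y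

/-- A linear Jordan automorphism: a linear bijection that preserves the Jordan product. -/
def IsJordanAut {A : NonUnitalSubalgebra ℂ (E →L[ℂ] E)} (θ : A ≃ₗ[ℂ] A) : Prop :=
  ∀ x y : A, θ (x * y + y * x) = θ x * θ y + θ y * θ x

theorem list_prod_mem (A : NonUnitalSubalgebra ℂ (E →L[ℂ] E)) :
    ∀ l : List (E →L[ℂ] E), l ≠ [] → (∀ x ∈ l, x ∈ A) → l.prod ∈ A
  | [], h, _ => absurd rfl h
  | [x], _, hx => by simpa using hx
  | x :: y :: l, _, hx => by
      rw [List.prod_cons]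
      exact A.mul_mem (hx x (by simp))
        (list_prod_mem A (y :: l) (by simp) fun z hz => hx z (List.mem_cons_of_mem x hz))

end

/-- A finite sequence `(i₁, …, i_m)` with `{i₁, …, i_m} = {1, …, k}`, `k ≥ 2`, and an index `i_p`
that is different from all the other indices `i_q`. Indices are counted from `0`. -/
structure IndexSeq (m k : ℕ) where
  idx : Fin m → Fin k
  two_le : 2 ≤ k
  surj : Function.Surjective idx
  exists_single : ∃ p : Fin m, ∀ q : Fin m, q ≠ p → idx q ≠ idx p

theorem IndexSeq.pos {m k : ℕ} (s : IndexSeq m k) : 0 < m := by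
  obtain ⟨p, -⟩ := s.exists_single
  exact p.pos

section

variable {E : Type*} [NormedAddCommGroup E] [NormedSpace ℂ E]

/-- The ordered product `T 0 * T 1 * ⋯ * T (m - 1)` of `m ≥ 1` elements of `A`. -/
noncomputable def wordProd {A : NonUnitalSubalgebra ℂ (E →L[ℂ] E)} {m : ℕ} (hm : 0 < m)
    (T : Fin m → A) : A :=
  ⟨(List.ofFn fun j => (T j : E →L[ℂ] E)).prod, list_prod_mem A _
    (fun h => hm.ne' (List.ofFn_eq_nil_iff.mp h))
    (fun x hx => by
      obtain ⟨j, rfl⟩ := (List.mem_ofFn' _ _).mp hx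
      exact (T j).2)⟩

/-- The generalized product `T_{i₁} ⋯ T_{i_m}`. -/
noncomputable def genProd {A : NonUnitalSubalgebra ℂ (E →L[ℂ] E)} {m k : ℕ} (s : IndexSeq m k)
    (T : Fin k → A) : A :=
  wordProd s.pos fun j => T (s.idx j)

/-- The generalized Jordan product `T_{i₁} ⋯ T_{i_m} + T_{i_m} ⋯ T_{i₁}`. -/
noncomputable def genJordanProd {A : NonUnitalSubalgebra ℂ (E →L[ℂ] E)} {m k : ℕ}
    (s : IndexSeq m k) (T : Fin k → A) : A :=
  wordProd s.pos (fun j => T (s.idx j)) + wordProd s.pos (fun j => T (s.idx j.rev))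

/-- `φ` has the form `T ↦ ξ S T S⁻¹` with `ξ ^ m = 1` and `S : E → E` an invertible bounded
operator, or the form `T ↦ ξ S T' S⁻¹` with `ξ ^ m = 1` and `S : E' → E` an invertible bounded
operator. -/
def HasStandardForm (m : ℕ) {A : NonUnitalSubalgebra ℂ (E →L[ℂ] E)} (φ : A → A) : Prop :=
  ∃ ξ : ℂ, ξ ^ m = 1 ∧
    ((∃ S : E ≃L[ℂ] E, ∀ T : A,
        (φ T : E →L[ℂ] E) =
          ξ • ((S : E →L[ℂ] E) ∘L (T : E →L[ℂ] E) ∘L (S.symm : E →L[ℂ] E))) ∨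
      (∃ S : StrongDual ℂ E ≃L[ℂ] E, ∀ T : A,
        (φ T : E →L[ℂ] E) =
          ξ • ((S : StrongDual ℂ E →L[ℂ] E) ∘L dualOp (T : E →L[ℂ] E) ∘L
            (S.symm : E →L[ℂ] StrongDual ℂ E))))

end

end OpProd

/-! Suppose that the index `i_p` occurs once, `r` times preceded and `s` times followed by other
indices. Putting `X` at this index and `B` at all others turns the product into the word
`B ^ r * X * B ^ s`, and the Jordan product into its sum with `B ^ s * X * B ^ r`.

*Recovering functionals.* Let `B` be a rank one idempotent `x ⊗ f`, so `f x = 1`. Then `φ B ^ m` is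
again a rank one idempotent `Q`, whence `φ B = c • Q + N` with `c ^ m = 1`, `Q * N = N * Q = 0` and
`N ^ m = 0`. Comparing ranks in the word for `φ B` and all operators `X` of small rank improves this
to `N ^ (m - 1) = 0`, so `φ B ^ (m - 1)` is a rank one operator `a ⊗ b` with `b a ^ m = 1`. As the
trace is invariant under Jordan automorphisms, `f (T x) = b (φ T a)` for all `T`.

*Globalizing.* If `φ (ψ y g) = y ⊗ g`, then `f (ψ y g x) = g a * b y` is a product of a functional
of `g` and a functional of `y`. So the bilinear map sending `(x, f)` to the form
`(g, y) ↦ f (ψ y g x)` takes values in the simple forms, and it has no zero divisors. Such a map is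
a tensor product of two linear maps, and its variables can be matched in two ways: one gives the
automorphisms, the other the antiautomorphisms. The two factors are adjoint to each other, so the
closed graph theorem makes them bounded.
-/

namespace OpProd

section FiniteRankTrace

variable {K V W : Type*} [Field K] [AddCommGroup V] [Module K V] [AddCommGroup W] [Module K W]

/-- The trace of an endomorphism of finite rank, that is, the trace of its restriction to its own
range. An endomorphism of infinite rank gets the junk value `0`. -/
noncomputable def finiteRankTrace (T : V →ₗ[K] V) : K :=
  LinearMap.trace K (LinearMap.range T) (T.rangeRestrict ∘ₗ (LinearMap.range T).subtype)

theorem finiteRankTrace_eq_trace_restrict (T : V →ₗ[K] V) (P : Submodule K V)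
    [FiniteDimensional K P] (hT : ∀ x, T x ∈ P) :
    finiteRankTrace T = LinearMap.trace K P (T.codRestrict P hT ∘ₗ P.subtype) := by
  have hle : LinearMap.range T ≤ P := by rintro _ ⟨x, rfl⟩; exact hT x
  have : FiniteDimensional K (LinearMap.range T) := Submodule.finiteDimensional_of_le hle
  exact LinearMap.trace_comp_comm' (Submodule.inclusion hle) (T.rangeRestrict ∘ₗ P.subtype)

theorem finiteRankTrace_comp [FiniteDimensional K W] (i : W →ₗ[K] V) (j : V →ₗ[K] W) :
    finiteRankTrace (i ∘ₗ j) = LinearMap.trace K W (j ∘ₗ i) := by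
  rw [finiteRankTrace_eq_trace_restrict _ (LinearMap.range i) fun x => ⟨j x, rfl⟩]
  exact LinearMap.trace_comp_comm' (j ∘ₗ (LinearMap.range i).subtype) i.rangeRestrict

theorem finiteRankTrace_mul_comm (S T : V →ₗ[K] V) [FiniteDimensional K (LinearMap.range T)] :
    finiteRankTrace (S * T) = finiteRankTrace (T * S) := by
  let i := (LinearMap.range T).subtype
  let j := T.rangeRestrict
  calc finiteRankTrace (S * T) = finiteRankTrace ((S ∘ₗ i) ∘ₗ j) := rfl
    _ = finiteRankTrace (i ∘ₗ (j ∘ₗ S)) := by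
      rw [finiteRankTrace_comp, finiteRankTrace_comp, LinearMap.comp_assoc]
    _ = finiteRankTrace (T * S) := rfl

theorem finiteRankTrace_smul (c : K) (T : V →ₗ[K] V) [FiniteDimensional K (LinearMap.range T)] :
    finiteRankTrace (c • T) = c * finiteRankTrace T := by
  rw [finiteRankTrace_eq_trace_restrict (c • T) (LinearMap.range T) fun x =>
    Submodule.smul_mem _ c ⟨x, rfl⟩]
  exact (LinearMap.trace K _).map_smul c (T.rangeRestrict ∘ₗ (LinearMap.range T).subtype)

theorem finiteRankTrace_add (S T : V →ₗ[K] V) [FiniteDimensional K (LinearMap.range S)]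
    [FiniteDimensional K (LinearMap.range T)] :
    finiteRankTrace (S + T) = finiteRankTrace S + finiteRankTrace T := by
  let P := LinearMap.range S ⊔ LinearMap.range T
  have hS : ∀ x, S x ∈ P := fun x => Submodule.mem_sup_left ⟨x, rfl⟩
  have hT : ∀ x, T x ∈ P := fun x => Submodule.mem_sup_right ⟨x, rfl⟩
  rw [finiteRankTrace_eq_trace_restrict S P hS, finiteRankTrace_eq_trace_restrict T P hT,
    finiteRankTrace_eq_trace_restrict (S + T) P fun x => P.add_mem (hS x) (hT x), ← map_add]
  rfl

theorem finiteRankTrace_sum_smulRight {ι : Type*} [Fintype ι] (f : ι → Module.Dual K V)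
    (x : ι → V) : finiteRankTrace (∑ i, (f i).smulRight (x i)) = ∑ i, f i (x i) := by
  classical
  have hfac : ∑ i, (f i).smulRight (x i) = Fintype.linearCombination K x ∘ₗ LinearMap.pi f := by
    ext v; simp [LinearMap.sum_apply, Fintype.linearCombination_apply]
  rw [hfac, finiteRankTrace_comp, LinearMap.trace_eq_matrix_trace K (Pi.basisFun K ι),
    Matrix.trace]
  simp [Fintype.linearCombination_apply_single]

theorem finiteRankTrace_smulRight (f : Module.Dual K V) (x : V) :
    finiteRankTrace (f.smulRight x) = f x := by
  simpa using finiteRankTrace_sum_smulRight (fun _ : Unit => f) fun _ => x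

end FiniteRankTrace

section RankOne

variable {𝕜 E : Type*} [NontriviallyNormedField 𝕜] [NormedAddCommGroup E] [NormedSpace 𝕜 E]

/-- The operator `y ↦ b y • a`, as a bilinear function of the vector `a` and the functional `b`. -/
noncomputable def rankOne : E →L[𝕜] StrongDual 𝕜 E →L[𝕜] E →L[𝕜] E :=
  (ContinuousLinearMap.smulRightL 𝕜 E E).flip

@[simp]
theorem rankOne_apply (a : E) (b : StrongDual 𝕜 E) (y : E) : rankOne a b y = b y • a := rfl

@[simp]
theorem mul_rankOne (T : E →L[𝕜] E) (a : E) (b : StrongDual 𝕜 E) :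
    T * rankOne a b = rankOne (T a) b := by
  ext y; simp

@[simp]
theorem rankOne_mul (T : E →L[𝕜] E) (a : E) (b : StrongDual 𝕜 E) :
    rankOne a b * T = rankOne a (b ∘L T) := rfl

theorem rankOne_mul_rankOne (a a' : E) (b b' : StrongDual 𝕜 E) :
    rankOne a b * rankOne a' b' = b a' • rankOne a b' := by simp

@[simp]
theorem finiteRankTrace_rankOne (a : E) (b : StrongDual 𝕜 E) :
    finiteRankTrace (rankOne a b : E →ₗ[𝕜] E) = b a :=
  finiteRankTrace_smulRight (b : E →ₗ[𝕜] 𝕜) a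

theorem finiteRankTrace_sum_rankOne {ι : Type*} [Fintype ι] (a : ι → E)
    (b : ι → StrongDual 𝕜 E) :
    finiteRankTrace ((∑ i, rankOne (a i) (b i) : E →L[𝕜] E) : E →ₗ[𝕜] E) = ∑ i, b i (a i) := by
  refine (congrArg finiteRankTrace ?_).trans
    (finiteRankTrace_sum_smulRight (fun i => (b i : E →ₗ[𝕜] 𝕜)) a)
  ext y
  simp [LinearMap.sum_apply]

theorem exists_eq_sum_rankOne [CompleteSpace 𝕜] (T : E →L[𝕜] E)
    [FiniteDimensional 𝕜 (LinearMap.range (T : E →ₗ[𝕜] E))] :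
    ∃ (a : Fin (Module.finrank 𝕜 (LinearMap.range (T : E →ₗ[𝕜] E))) → E)
      (b : Fin (Module.finrank 𝕜 (LinearMap.range (T : E →ₗ[𝕜] E))) → StrongDual 𝕜 E),
      T = ∑ i, rankOne (a i) (b i) := by
  let w := Module.finBasis 𝕜 (LinearMap.range (T : E →ₗ[𝕜] E))
  let T' : E →L[𝕜] LinearMap.range (T : E →ₗ[𝕜] E) := T.codRestrict _ fun x => ⟨x, rfl⟩
  refine ⟨fun i => w i, fun i => LinearMap.toContinuousLinearMap (w.coord i) ∘L T', ?_⟩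
  ext y
  have hy := congrArg Subtype.val (w.sum_repr (T' y))
  simp only [Submodule.coe_sum, Submodule.coe_smul] at hy
  rw [sum_apply]
  exact hy.symm

theorem exists_apply_eq_one {f : StrongDual 𝕜 E} (hf : f ≠ 0) : ∃ x : E, f x = 1 := by
  obtain ⟨x, hx⟩ := DFunLike.ne_iff.mp hf
  exact ⟨(f x)⁻¹ • x, by simpa using inv_mul_cancel₀ hx⟩

theorem exists_dual_family [SeparatingDual 𝕜 E] {n : ℕ} {v : Fin n → E}
    (hv : LinearIndependent 𝕜 v) :
    ∃ f : Fin n → StrongDual 𝕜 E, ∀ i j, f i (v j) = (1 : Matrix (Fin n) (Fin n) 𝕜) i j := by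
  have h := (SeparatingDual.dualMap_surjective_iff (R := 𝕜)
    (f := Fintype.linearCombination 𝕜 v)).mpr
      (linearIndependent_iff_injective_fintypeLinearCombination.mp hv)
  choose f hf using fun i => h (LinearMap.proj i)
  refine ⟨f, fun i j => ?_⟩
  simpa [Fintype.linearCombination_apply_single, Matrix.one_apply, Pi.single_apply] using
    LinearMap.congr_fun (hf i) (Pi.single j 1)

theorem linearIndependent_of_det_ne_zero {n : ℕ} {w : Fin n → E} (k : Fin n → StrongDual 𝕜 E)
    (h : (Matrix.of fun i j => k i (w j)).det ≠ 0) : LinearIndependent 𝕜 w := by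
  refine Fintype.linearIndependent_iff.mpr fun g hg =>
    congrFun (Matrix.eq_zero_of_mulVec_eq_zero h ?_)
  ext i
  simpa [Matrix.mulVec, dotProduct, mul_comm] using congrArg (k i) hg

end RankOne

theorem exists_det_one_add_smul_ne_zero {K ι : Type*} [Field K] [Infinite K] [Fintype ι]
    [DecidableEq ι] (M N : Matrix ι ι K) :
    ∃ t : K, (1 + t • M).det ≠ 0 ∧ (N + t • 1).det ≠ 0 := by
  have hM : (-M).charpolyRev ≠ 0 := fun h => by
    simpa [h] using Matrix.eval_charpolyRev (M := -M)
  obtain ⟨t, ht⟩ : ∃ t, ((-M).charpolyRev * (-N).charpoly).eval t ≠ 0 := by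
    by_contra! h
    exact mul_ne_zero hM (-N).charpoly_monic.ne_zero (Polynomial.funext (by simpa using h))
  rw [Polynomial.eval_mul] at ht
  refine ⟨t, ?_, ?_⟩
  · convert left_ne_zero_of_mul ht using 1
    rw [Matrix.charpolyRev, ← Polynomial.coe_evalRingHom, RingHom.map_det]
    congr 1
    ext i j
    by_cases h : i = j <;> simp [h, mul_comm t]
  · convert right_ne_zero_of_mul ht using 1
    rw [Matrix.eval_charpoly]
    congr 1
    simp [add_comm, Matrix.smul_one_eq_diagonal]

/-- A family `k` biorthogonal to `v` is found on the line through a dual family of `v` and a dual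
family of `w`. -/
theorem exists_dual_family_det_ne_zero {𝕜 E : Type*} [NontriviallyNormedField 𝕜]
    [NormedAddCommGroup E] [NormedSpace 𝕜 E] [SeparatingDual 𝕜 E] {n : ℕ} {v w : Fin n → E}
    (hv : LinearIndependent 𝕜 v) (hw : LinearIndependent 𝕜 w) :
    ∃ k : Fin n → StrongDual 𝕜 E, (∀ i j, k i (v j) = (1 : Matrix (Fin n) (Fin n) 𝕜) i j) ∧
      (Matrix.of fun i j => k i (w j)).det ≠ 0 := by
  obtain ⟨f, hf⟩ := exists_dual_family hv
  obtain ⟨f', hf'⟩ := exists_dual_family hw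
  have : Infinite 𝕜 := NontriviallyNormedField.infinite 𝕜
  obtain ⟨t, hH, hN⟩ := exists_det_one_add_smul_ne_zero (Matrix.of fun i j => f' i (v j))
    (Matrix.of fun i j => f i (w j))
  set H := 1 + t • (Matrix.of fun i j => f' i (v j)) with hHdef
  set N := (Matrix.of fun i j => f i (w j)) + t • (1 : Matrix (Fin n) (Fin n) 𝕜) with hNdef
  refine ⟨fun i => ∑ l, H⁻¹ i l • (f l + t • f' l), fun i j => ?_, ?_⟩
  · rw [← Matrix.nonsing_inv_mul H (isUnit_iff_ne_zero.mpr hH), Matrix.mul_apply]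
    simp [sum_apply, hHdef, hf, mul_add]
  · have : (Matrix.of fun i j => (∑ l, H⁻¹ i l • (f l + t • f' l)) (w j)) = H⁻¹ * N := by
      ext i j
      simp [Matrix.mul_apply, sum_apply, hNdef, hf', mul_add]
    rw [this, Matrix.det_mul]
    exact mul_ne_zero (by simpa using hH) hN

section RankLE

variable {E : Type*} [NormedAddCommGroup E] [NormedSpace ℂ E] {T : E →L[ℂ] E} {d : ℕ}

theorem RankLE.finiteDimensional_range (h : RankLE d T) :
    FiniteDimensional ℂ (LinearMap.range (T : E →ₗ[ℂ] E)) :=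
  Module.rank_lt_aleph0_iff.mp (h.trans_lt Cardinal.natCast_lt_aleph0)

theorem RankLE.finrank_le (h : RankLE d T) :
    Module.finrank ℂ (LinearMap.range (T : E →ₗ[ℂ] E)) ≤ d :=
  Module.finrank_le_of_rank_le h

theorem RankLE.mono {d' : ℕ} (h : RankLE d T) (hd : d ≤ d') : RankLE d' T :=
  h.trans (by exact_mod_cast hd)

theorem RankLE.add {d' : ℕ} {T' : E →L[ℂ] E} (h : RankLE d T) (h' : RankLE d' T') :
    RankLE (d + d') (T + T') := by
  rw [RankLE, Nat.cast_add]
  exact (LinearMap.rank_add_le _ _).trans (add_le_add h h')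

theorem RankLE.mul_left (h : RankLE d T) (S : E →L[ℂ] E) : RankLE d (S * T) :=
  (by simpa using LinearMap.lift_rank_comp_le_right (T : E →ₗ[ℂ] E) (S : E →ₗ[ℂ] E) :
    LinearMap.rank ((S : E →ₗ[ℂ] E) ∘ₗ (T : E →ₗ[ℂ] E)) ≤ _).trans h

theorem RankLE.mul_right (h : RankLE d T) (S : E →L[ℂ] E) : RankLE d (T * S) :=
  (LinearMap.rank_comp_le_left (S : E →ₗ[ℂ] E) (T : E →ₗ[ℂ] E)).trans h

theorem RankLE.smul (h : RankLE d T) (c : ℂ) : RankLE d (c • T) := by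
  simpa using h.mul_left (c • 1)

theorem RankLE.eq_zero (h : RankLE 0 T) : T = 0 := by
  have hT : LinearMap.range (T : E →ₗ[ℂ] E) = ⊥ := by simpa [RankLE, LinearMap.rank] using h
  exact ContinuousLinearMap.coe_injective (LinearMap.range_eq_bot.mp hT)

theorem rankLE_rankOne (a : E) (b : StrongDual ℂ E) : RankLE 1 (rankOne a b) := by
  rw [RankLE, Nat.cast_one]
  refine (rank_submodule_le_one_iff' _).mpr ⟨a, ?_⟩
  rintro _ ⟨y, rfl⟩
  exact Submodule.mem_span_singleton.mpr ⟨b y, rfl⟩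

theorem rankLE_sum_rankOne {ι : Type*} (s : Finset ι) (a : ι → E) (b : ι → StrongDual ℂ E) :
    RankLE s.card (∑ i ∈ s, rankOne (a i) (b i)) := by
  classical
  induction s using Finset.induction_on with
  | empty => simp [RankLE]
  | insert i s hi ih =>
    rw [Finset.sum_insert hi, Finset.card_insert_of_notMem hi, add_comm s.card]
    exact (rankLE_rankOne _ _).add ih

theorem RankLE.exists_rankOne (h : RankLE 1 T) : ∃ a b, T = rankOne a b := by
  have := h.finiteDimensional_range
  obtain ⟨a, b, hT⟩ := exists_eq_sum_rankOne T
  have hn := h.finrank_le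
  generalize Module.finrank ℂ (LinearMap.range (T : E →ₗ[ℂ] E)) = n at a b hT hn
  interval_cases n
  · exact ⟨0, 0, by simpa using hT⟩
  · exact ⟨a 0, b 0, by simpa using hT⟩

theorem IsStandard.mem_of_rankLE {A : NonUnitalSubalgebra ℂ (E →L[ℂ] E)} (hA : IsStandard A)
    (h : RankLE d T) : T ∈ A :=
  hA T h.finiteDimensional_range

theorem IsStandard.rankOne_mem {A : NonUnitalSubalgebra ℂ (E →L[ℂ] E)} (hA : IsStandard A)
    (a : E) (b : StrongDual ℂ E) : rankOne a b ∈ A :=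
  hA.mem_of_rankLE (rankLE_rankOne a b)

theorem rankLE_iff_not_linearIndependent :
    RankLE d T ↔ ∀ v : Fin (d + 1) → E, ¬ LinearIndependent ℂ fun i => T (v i) := by
  have hlt : RankLE d T ↔
      ¬ ((d + 1 : ℕ) : Cardinal) ≤ Module.rank ℂ (LinearMap.range (T : E →ₗ[ℂ] E)) := by
    rw [not_le, Nat.cast_succ, ← Cardinal.succ_natCast, Order.lt_succ_iff]
    rfl
  rw [hlt, Module.le_rank_iff, ← not_exists, not_iff_not]
  constructor
  · rintro ⟨w, hw⟩
    choose v hv using fun i => (w i).2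
    have hTv : (fun i => T (v i)) = Submodule.subtype _ ∘ w := funext hv
    exact ⟨v, hTv ▸ hw.map' (Submodule.subtype _) (Submodule.ker_subtype _)⟩
  · rintro ⟨v, hv⟩
    exact ⟨fun i => ⟨T (v i), v i, rfl⟩, LinearIndependent.of_comp (Submodule.subtype _) hv⟩

theorem rankLE_of_compression
    (h : ∀ R : E →L[ℂ] E, R * R = R → RankLE (d + 1) R → RankLE d (R * T * R)) : RankLE d T := by
  refine rankLE_iff_not_linearIndependent.mpr fun v hTv => ?_
  obtain ⟨k, hkv, hkT⟩ :=
    exists_dual_family_det_ne_zero (LinearIndependent.of_comp (T : E →ₗ[ℂ] E) hTv) hTv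
  let R : E →L[ℂ] E := ∑ i, rankOne (v i) (k i)
  have hR : ∀ y, R y = ∑ i, k i y • v i := fun y => by simp [R, sum_apply]
  have hRv : ∀ j, R (v j) = v j := fun j => by simp [hR, hkv, Matrix.one_apply]
  have hkR : ∀ i y, k i (R y) = k i y := fun i y => by simp [hR, hkv, Matrix.one_apply]
  have hRR : R * R = R := by
    ext y
    rw [mul_apply_eq_comp, hR (R y), hR y]
    simp only [← hR y, hkR]
  have hrank : RankLE (d + 1) R := by simpa using rankLE_sum_rankOne Finset.univ v k
  refine rankLE_iff_not_linearIndependent.mp (h R hRR hrank) v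
    (linearIndependent_of_det_ne_zero k ?_)
  simpa [hRv, hkR] using hkT

end RankLE

section SimpleForms

variable {K G H : Type*} [Field K] [AddCommGroup G] [Module K G] [AddCommGroup H] [Module K H]

open Module (Dual)

/-- A bilinear form is simple if it is the product `p ⊗ q` of two functionals. -/
def IsSimple (β : G →ₗ[K] H →ₗ[K] K) : Prop :=
  ∃ (p : Dual K G) (q : Dual K H), ∀ g h, β g h = p g * q h

/-- Two functionals are proportional if one is a multiple of the other, expressed through the
vanishing of `p ∧ p'`. -/
def Proportional (p p' : Dual K G) : Prop :=
  ∀ g g', p g * p' g' = p g' * p' g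

theorem isSimple_iff_minors {β : G →ₗ[K] H →ₗ[K] K} :
    IsSimple β ↔ ∀ g g' h h', β g h * β g' h' = β g h' * β g' h := by
  refine ⟨fun ⟨p, q, hβ⟩ g g' h h' => by simp only [hβ]; ring, fun hβ => ?_⟩
  by_cases h0 : ∃ g h, β g h ≠ 0
  · obtain ⟨g₀, h₀, hne⟩ := h0
    refine ⟨β.flip h₀, (β g₀ h₀)⁻¹ • β g₀, fun g h => ?_⟩
    simp only [LinearMap.flip_apply, LinearMap.smul_apply, smul_eq_mul]
    field_simp
    linear_combination hβ g g₀ h h₀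
  · push Not at h0
    exact ⟨0, 0, by simp [h0]⟩

theorem IsSimple.of_add_sub [NeZero (2 : K)] {β γ : G →ₗ[K] H →ₗ[K] K} (hγ : IsSimple γ)
    (hadd : IsSimple (β + γ)) (hsub : IsSimple (β - γ)) : IsSimple β := by
  rw [isSimple_iff_minors] at hγ hadd hsub ⊢
  intro g g' h h'
  have h₁ := hadd g g' h h'
  have h₂ := hsub g g' h h'
  simp only [LinearMap.add_apply, LinearMap.sub_apply] at h₁ h₂
  refine mul_left_cancel₀ (two_ne_zero (α := K)) ?_
  linear_combination h₁ + h₂ - 2 * hγ g g' h h'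

theorem IsSimple.smul {β : G →ₗ[K] H →ₗ[K] K} (hβ : IsSimple β) (c : K) : IsSimple (c • β) := by
  obtain ⟨p, q, hβ⟩ := hβ
  exact ⟨c • p, q, fun g h => by simp [hβ, mul_assoc]⟩

theorem IsSimple.flip {β : G →ₗ[K] H →ₗ[K] K} (hβ : IsSimple β) : IsSimple β.flip := by
  obtain ⟨p, q, hβ⟩ := hβ
  exact ⟨q, p, fun h g => by rw [LinearMap.flip_apply, hβ, mul_comm]⟩

theorem Proportional.symm {p p' : Dual K G} (h : Proportional p p') : Proportional p' p :=
  fun g g' => by rw [mul_comm, h g' g, mul_comm]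

theorem Proportional.exists_eq_smul {p p' : Dual K G} (h : Proportional p p') (hp : p ≠ 0) :
    ∃ c : K, p' = c • p := by
  obtain ⟨g₀, hg₀⟩ := DFunLike.ne_iff.mp hp
  refine ⟨p' g₀ / p g₀, LinearMap.ext fun g => ?_⟩
  rw [LinearMap.zero_apply] at hg₀
  simp only [LinearMap.smul_apply, smul_eq_mul]
  field_simp
  linear_combination h g₀ g

theorem Proportional.exists_eq_smul_of_injective {V : Type*} [AddCommGroup V] [Module K V]
    {S : V →ₗ[K] Dual K G} (hS : ∀ v, S v = 0 → v = 0) {e v : V} (he : e ≠ 0)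
    (h : Proportional (S e) (S v)) : ∃ c : K, v = c • e := by
  obtain ⟨c, hc⟩ := h.exists_eq_smul (mt (hS e) he)
  exact ⟨c, sub_eq_zero.mp (hS _ (by simp [hc]))⟩

theorem IsSimple.proportional_or {β : G →ₗ[K] H →ₗ[K] K} (hβ : IsSimple β) {p p' : Dual K G}
    {q q' : Dual K H} (h : ∀ g h, β g h = p g * q h + p' g * q' h) :
    Proportional p p' ∨ Proportional q q' := by
  by_contra! hc
  simp only [Proportional, not_forall] at hc
  obtain ⟨⟨g, g', hg⟩, h₁, h₂, hh⟩ := hc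
  have hminor := isSimple_iff_minors.mp hβ g g' h₁ h₂
  simp only [h] at hminor
  exact mul_ne_zero (sub_ne_zero.mpr hg) (sub_ne_zero.mpr hh) (by linear_combination hminor)

theorem mul_eq_mul_of_isSimple {a s p : Dual K G} {b t q : Dual K H} (hs : ¬ Proportional p s)
    (ht : ¬ Proportional q t) (hrow : IsSimple (a.smulRight b + p.smulRight t))
    (hcol : IsSimple (a.smulRight b + s.smulRight q))
    (hsum : IsSimple (a.smulRight b + s.smulRight q + p.smulRight t + p.smulRight q)) (g : G)
    (h : H) : a g * b h = s g * t h := by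
  have hwedge : ∀ g g' h h', (a g * p g' - a g' * p g) * (b h * q h' - b h' * q h) =
      (p g * s g' - p g' * s g) * (q h * t h' - q h' * t h) := by
    intro g g' h h'
    have h₁ := isSimple_iff_minors.mp hrow g g' h h'
    have h₂ := isSimple_iff_minors.mp hcol g g' h h'
    have h₃ := isSimple_iff_minors.mp hsum g g' h h'
    simp only [LinearMap.add_apply, LinearMap.smulRight_apply, LinearMap.smul_apply,
      smul_eq_mul] at h₁ h₂ h₃
    linear_combination h₃ - h₁ - h₂
  obtain ⟨g₁, g₂, hg⟩ : ∃ g₁ g₂, p g₁ * s g₂ - p g₂ * s g₁ ≠ 0 := by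
    simpa [Proportional, sub_eq_zero] using hs
  obtain ⟨h₁, h₂, hh⟩ : ∃ h₁ h₂, q h₁ * t h₂ - q h₂ * t h₁ ≠ 0 := by
    simpa [Proportional, sub_eq_zero] using ht
  have hne := (hwedge g₁ g₂ h₁ h₂).trans_ne (mul_ne_zero hg hh)
  have hap : ¬ Proportional a p := fun H =>
    left_ne_zero_of_mul hne (sub_eq_zero.mpr (H g₁ g₂))
  have hbq : ¬ Proportional b q := fun H =>
    right_ne_zero_of_mul hne (sub_eq_zero.mpr (H h₁ h₂))
  have has := (hcol.proportional_or (fun _ _ => rfl)).resolve_right hbq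
  have hbt := (hrow.proportional_or (fun _ _ => rfl)).resolve_left hap
  obtain ⟨l, rfl⟩ := has.symm.exists_eq_smul (by rintro rfl; simp at hg)
  obtain ⟨n, rfl⟩ := hbt.symm.exists_eq_smul (by rintro rfl; simp at hh)
  have hln : l * n = 1 := by
    refine mul_right_cancel₀ (mul_ne_zero hg hh) ?_
    simp only [LinearMap.smul_apply, smul_eq_mul] at hwedge
    linear_combination hwedge g₁ g₂ h₁ h₂
  simp only [LinearMap.smul_apply, smul_eq_mul]
  linear_combination s g * t h * hln

/-- Along a linear family of simple forms through `p ⊗ q` one of the two factors is constant: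
each member shares a factor with `p ⊗ q`, and a vector space is not the union of two proper
subspaces. -/
theorem exists_common_factor {V : Type*} [AddCommGroup V] [Module K V]
    (L : V →ₗ[K] G →ₗ[K] H →ₗ[K] K) (hL : ∀ v, IsSimple (L v)) {e : V} {p : Dual K G}
    {q : Dual K H} (he : ∀ g h, L e g h = p g * q h) (hp : p ≠ 0) (hq : q ≠ 0) :
    (∃ S : V →ₗ[K] Dual K G, S e = p ∧ ∀ v g h, L v g h = S v g * q h) ∨
      ∃ S : V →ₗ[K] Dual K H, S e = q ∧ ∀ v g h, L v g h = p g * S v h := by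
  obtain ⟨g₀, hg₀⟩ : ∃ g, p g = 1 := LinearMap.surjective hp 1
  obtain ⟨h₀, hh₀⟩ : ∃ h, q h = 1 := LinearMap.surjective hq 1
  have hfactor : ∀ v, (∀ g h, L v g h = L v g h₀ * q h) ∨ ∀ g h, L v g h = p g * L v g₀ h := by
    intro v
    obtain ⟨p', q', hv⟩ := hL v
    have hadd : ∀ g h, L (e + v) g h = p g * q h + p' g * q' h := fun g h => by simp [he, hv]
    rcases (hL (e + v)).proportional_or hadd with hpp | hqq
    · obtain ⟨c, rfl⟩ := hpp.exists_eq_smul hp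
      exact .inr fun g h => by simp [hv, hg₀]; ring
    · obtain ⟨c, rfl⟩ := hqq.exists_eq_smul hq
      exact .inl fun g h => by simp [hv, hh₀]; ring
  have huniform : (∀ v g h, L v g h = L v g h₀ * q h) ∨ ∀ v g h, L v g h = p g * L v g₀ h := by
    by_contra! hc
    obtain ⟨⟨v, g, h, hv⟩, v', g', h', hv'⟩ := hc
    have hl := (hfactor v).resolve_left fun H => hv (H g h)
    have hr := (hfactor v').resolve_right fun H => hv' (H g' h')
    rcases hfactor (v + v') with hs | hs
    · have := hs g h
      simp only [map_add, LinearMap.add_apply] at this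
      exact hv (by linear_combination this - hr g h)
    · have := hs g' h'
      simp only [map_add, LinearMap.add_apply] at this
      exact hv' (by linear_combination this - hl g' h')
  rcases huniform with h | h
  · exact .inl ⟨L.compr₂ (LinearMap.applyₗ h₀), by ext; simp [he, hh₀], h⟩
  · exact .inr ⟨L.flip g₀, by ext; simp [he, hg₀], h⟩

variable {X Y : Type*} [AddCommGroup X] [Module K X] [AddCommGroup Y] [Module K Y]
  {F : X →ₗ[K] Y →ₗ[K] G →ₗ[K] H →ₗ[K] K} {x₀ : X} {y₀ : Y}

theorem eq_mul_of_axes (hF : ∀ x y, IsSimple (F x y)) (hne : ∀ x y, F x y = 0 → x = 0 ∨ y = 0)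
    (hx₀ : x₀ ≠ 0) (hy₀ : y₀ ≠ 0) {S : X →ₗ[K] Dual K G} {T : Y →ₗ[K] Dual K H}
    (hS : ∀ x g h, F x y₀ g h = S x g * T y₀ h) (hT : ∀ y g h, F x₀ y g h = S x₀ g * T y h)
    (x : X) (y : Y) (g : G) (h : H) : F x y g h = S x g * T y h := by
  have hSinj : ∀ x, S x = 0 → x = 0 := fun x hx =>
    (hne x y₀ (by ext; simp [hS, hx])).resolve_right hy₀
  have hTinj : ∀ y, T y = 0 → y = 0 := fun y hy =>
    (hne x₀ y (by ext; simp [hT, hy])).resolve_left hx₀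
  by_cases hSx : Proportional (S x₀) (S x)
  · obtain ⟨c, rfl⟩ := hSx.exists_eq_smul_of_injective hSinj hx₀
    simp [hT, mul_assoc]
  by_cases hTy : Proportional (T y₀) (T y)
  · obtain ⟨c, rfl⟩ := hTy.exists_eq_smul_of_injective hTinj hy₀
    simp [hS, mul_left_comm]
  obtain ⟨a, b, hab⟩ := hF x y
  rw [hab]
  refine mul_eq_mul_of_isSimple hSx hTy ?_ ?_ ?_ g h
  · convert hF (x + x₀) y using 1
    ext g h
    simp [hab, hT]
  · convert hF x (y + y₀) using 1
    ext g h
    simp [hab, hS]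
  · convert hF (x + x₀) (y + y₀) using 1
    ext g h
    simp [hab, hS, hT]
    ring

theorem eq_zero_of_common_factor (hF : ∀ x y, IsSimple (F x y))
    (hne : ∀ x y, F x y = 0 → x = 0 ∨ y = 0) (hx₀ : x₀ ≠ 0) (hy₀ : y₀ ≠ 0) {p : Dual K G}
    {S : X →ₗ[K] Dual K H} {T : Y →ₗ[K] Dual K H} (hS : ∀ x g h, F x y₀ g h = p g * S x h)
    (hT : ∀ y g h, F x₀ y g h = p g * T y h) (x : X) (y : Y) {g : G} (hg : p g = 0) (h : H) :
    F x y g h = 0 := by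
  have hSinj : ∀ x, S x = 0 → x = 0 := fun x hx =>
    (hne x y₀ (by ext; simp [hS, hx])).resolve_right hy₀
  by_cases hSx : Proportional (S x₀) (S x)
  · obtain ⟨c, rfl⟩ := hSx.exists_eq_smul_of_injective hSinj hx₀
    simp [hT, hg]
  obtain ⟨a, b, hab⟩ := hF x y
  have hp : p ≠ 0 := by
    rintro rfl
    exact hx₀ ((hne x₀ y₀ (by ext; simp [hS])).resolve_right hy₀)
  rw [hab]
  by_cases hap : Proportional p a
  · obtain ⟨c, rfl⟩ := hap.exists_eq_smul hp
    simp [hg]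
  by_cases hb : b = 0
  · simp [hb]
  have hbT := ((hF (x + x₀) y).proportional_or (p := p) (p' := a) (q := T y) (q' := b)
    fun g h => by simp [hab, hT, add_comm]).resolve_left hap
  have hbS := ((hF x (y + y₀)).proportional_or (p := p) (p' := a) (q := S x) (q' := b)
    fun g h => by simp [hab, hS, add_comm]).resolve_left hap
  have hbsum := ((hF (x + x₀) (y + y₀)).proportional_or (p := p) (p' := a)
    (q := T y + S x + S x₀) (q' := b) fun g h => by simp [hab, hS, hT]; ring).resolve_left hap
  obtain ⟨t, ht⟩ := hbT.symm.exists_eq_smul hb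
  obtain ⟨s, hs⟩ := hbS.symm.exists_eq_smul hb
  obtain ⟨r, hr⟩ := hbsum.symm.exists_eq_smul hb
  have hx₀b : S x₀ = (r - t - s) • b := by
    linear_combination (norm := module) hr - ht - hs
  refine absurd (fun h h' => ?_) hSx
  simp only [hx₀b, hs, LinearMap.smul_apply, smul_eq_mul]
  ring

/-- Moving only `x`, or only `y`, away from a nonzero value of `F` keeps one of its two factors
constant. By `hG` and `hH` it is not the same factor for both. -/
theorem exists_factorization (hF : ∀ x y, IsSimple (F x y))
    (hne : ∀ x y, F x y = 0 → x = 0 ∨ y = 0)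
    (hG : ∀ p : Dual K G, ∃ x y g h, p g = 0 ∧ F x y g h ≠ 0)
    (hH : ∀ q : Dual K H, ∃ x y g h, q h = 0 ∧ F x y g h ≠ 0) :
    (∃ (S : X →ₗ[K] Dual K G) (T : Y →ₗ[K] Dual K H), ∀ x y g h, F x y g h = S x g * T y h) ∨
      ∃ (S : Y →ₗ[K] Dual K G) (T : X →ₗ[K] Dual K H), ∀ x y g h, F x y g h = S y g * T x h := by
  obtain ⟨x₀, y₀, g₀, h₀, -, h0⟩ := hG 0
  have hx₀ : x₀ ≠ 0 := by rintro rfl; simp at h0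
  have hy₀ : y₀ ≠ 0 := by rintro rfl; simp at h0
  obtain ⟨p, q, hpq⟩ := hF x₀ y₀
  have hp : p ≠ 0 := by rintro rfl; simp [hpq] at h0
  have hq : q ≠ 0 := by rintro rfl; simp [hpq] at h0
  rcases exists_common_factor (F.flip y₀) (fun x => hF x y₀) hpq hp hq with
    ⟨S, hSp, hS⟩ | ⟨S, hSq, hS⟩ <;>
  rcases exists_common_factor (F x₀) (hF x₀) hpq hp hq with ⟨T, hTp, hT⟩ | ⟨T, hTq, hT⟩
  · obtain ⟨x, y, g, h, hqh, hne0⟩ := hH q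
    let flip : (G →ₗ[K] H →ₗ[K] K) ≃ₗ[K] H →ₗ[K] G →ₗ[K] K := LinearMap.lflip
    exact absurd (eq_zero_of_common_factor (F := F.compr₂ flip.toLinearMap)
      (fun x y => (hF x y).flip) (fun x y h => hne x y (flip.map_eq_zero_iff.mp h)) hx₀ hy₀
      (fun x h g => (hS x g h).trans (mul_comm _ _))
      (fun y h g => (hT y g h).trans (mul_comm _ _)) x y hqh g) hne0
  · subst hSp hTq
    exact .inl ⟨S, T, eq_mul_of_axes hF hne hx₀ hy₀ hS hT⟩
  · subst hTp hSq
    exact .inr ⟨T, S, fun x y => eq_mul_of_axes (F := F.flip) (fun y x => hF x y)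
      (fun y x h => (hne x y h).symm) hy₀ hx₀ hT hS y x⟩
  · obtain ⟨x, y, g, h, hpg, hne0⟩ := hG p
    exact absurd (eq_zero_of_common_factor hF hne hx₀ hy₀ hS hT x y hpg h) hne0

end SimpleForms

section Pairing

variable {K Z V : Type*} [Field K] [AddCommGroup Z] [Module K Z] [AddCommGroup V] [Module K V]
  {p τ : Z →ₗ[K] V →ₗ[K] K}

theorem eq_zero_of_pairing_eq_one (hp : ∀ w, w ≠ 0 → ∃ z, p z w = 1)
    (hτ : ∀ z w, p z w = 1 → τ z w = 0) : τ = 0 := by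
  ext z w
  by_cases hw : w = 0
  · simp [hw]
  obtain ⟨h, hh⟩ := hp w hw
  simpa [hτ h w hh] using hτ (z + (1 - p z w) • h) w (by simp [hh])

theorem eq_zero_of_pow_eq_one {m : ℕ} (hm : m ≠ 0) (hp : ∀ w, w ≠ 0 → ∃ z, p z w = 1)
    (hτ : ∀ z w, p z w = 1 → τ z w ^ m = 1) {z : Z} {w : V} (hzw : p z w = 0) : τ z w = 0 := by
  by_contra hne
  obtain ⟨h, hh⟩ := hp w (by rintro rfl; simp at hne)
  have h0 : τ (h - (τ h w / τ z w) • z) w = 0 := by simp [hne]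
  have h1 := hτ (h - (τ h w / τ z w) • z) w (by simp [hh, hzw])
  rw [h0, zero_pow hm] at h1
  exact zero_ne_one h1

theorem eq_mul_pairing (hτ : ∀ z w, p z w = 0 → τ z w = 0) {e₀ : Z} {e : V} (he : p e₀ e = 1)
    (z : Z) (w : V) : τ z w = τ e₀ e * p z w := by
  have h₁ := hτ (z - p z e • e₀) e (by simp [he])
  have h₂ := hτ e₀ (w - p e₀ w • e) (by simp [he])
  have h₃ := hτ (z - p z e • e₀ - (p z w - p e₀ w * p z e) • e₀) (w - p e₀ w • e + e)
    (by simp [he])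
  simp only [map_sub, map_add, map_smul, LinearMap.sub_apply, LinearMap.smul_apply,
    smul_eq_mul] at h₁ h₂ h₃
  linear_combination h₃ + (p z e + (p z w - p e₀ w * p z e)) * h₂ + (p e₀ w - 1) * h₁

theorem exists_eq_mul_pairing [Nontrivial V] {m : ℕ} (hm : m ≠ 0)
    (hp : ∀ w, w ≠ 0 → ∃ z, p z w = 1) (hτ : ∀ z w, p z w = 1 → τ z w ^ m = 1) :
    ∃ c : K, c ^ m = 1 ∧ ∀ z w, τ z w = c * p z w := by
  obtain ⟨e, he⟩ := exists_ne (0 : V)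
  obtain ⟨e₀, he₀⟩ := hp e he
  exact ⟨τ e₀ e, hτ e₀ e he₀, eq_mul_pairing (fun _ _ => eq_zero_of_pow_eq_one hm hp hτ) he₀⟩

end Pairing

section Intertwining

variable {E V Z ι : Type*} [NormedAddCommGroup E] [NormedSpace ℂ E] [CompleteSpace E]
  [NormedAddCommGroup V] [NormedSpace ℂ V] [CompleteSpace V] [Nontrivial V]

/-- The operator `R` is bounded because `T z ∘ R = p z` exhibits its inverse as closed. -/
theorem exists_intertwiner (φ : ι → E →L[ℂ] E) (hrange : ∀ y g, ∃ C, φ C = rankOne y g)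
    (α : ι → V →L[ℂ] V) (p : Z → StrongDual ℂ V) (hp : ∀ w, (∀ z, p z w = 0) → w = 0)
    (S : V →ₗ[ℂ] E) (T : Z → StrongDual ℂ E) (hT : ∀ y, (∀ z, T z y = 0) → y = 0)
    (hTS : ∀ z w, T z (S w) = p z w) {c : ℂ} (h : ∀ C z w, T z (φ C (S w)) = c * p z (α C w)) :
    ∃ R : V ≃L[ℂ] E, ∀ C,
      φ C = c • ((R : V →L[ℂ] E) ∘L α C ∘L (R.symm : E →L[ℂ] V)) := by
  have hinj : ∀ w, S w = 0 → w = 0 := fun w hw => hp w fun z => by rw [← hTS, hw, map_zero]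
  have hφ : ∀ C w, φ C (S w) = c • S (α C w) := fun C w => by
    refine sub_eq_zero.mp (hT _ fun z => ?_)
    rw [map_sub, h, map_smul, hTS, smul_eq_mul, sub_self]
  have hsurj : Function.Surjective S := fun y => by
    obtain ⟨w₀, hw₀⟩ := exists_ne (0 : V)
    obtain ⟨g, hg⟩ := SeparatingDual.exists_eq_one (R := ℂ) (mt (hinj w₀) hw₀)
    obtain ⟨C, hC⟩ := hrange y g
    refine ⟨c • α C w₀, ?_⟩
    rw [map_smul, ← hφ, hC, rankOne_apply, hg, one_smul]
  let L := LinearEquiv.ofBijective S ⟨(injective_iff_map_eq_zero S).mpr hinj, hsurj⟩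
  have hL : ∀ z y, p z (L.symm y) = T z y := fun z y => by
    rw [← hTS]
    exact congrArg (T z) (L.apply_symm_apply y)
  have hcont : Continuous L.symm := by
    refine LinearMap.continuous_of_seq_closed_graph (g := (L.symm : E →ₗ[ℂ] V))
      fun s y w hs hw => sub_eq_zero.mp (hp _ fun z => ?_)
    have hlim := ((p z).continuous.tendsto w).comp hw
    rw [show p z ∘ (L.symm : E →ₗ[ℂ] V) ∘ s = T z ∘ s from funext fun n => hL z (s n)] at hlim
    rw [map_sub, sub_eq_zero]
    exact (tendsto_nhds_unique hlim (((T z).continuous.tendsto y).comp hs)).trans (hL z y).symm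
  let R := (L.symm.toContinuousLinearEquivOfContinuous hcont).symm
  refine ⟨R, fun C => ?_⟩
  ext y
  obtain ⟨w, rfl⟩ := R.surjective y
  change φ C (R w) = c • R (α C (R.symm (R w)))
  rw [R.symm_apply_apply]
  exact hφ C w

end Intertwining

section Functionals

variable {E : Type*} [NormedAddCommGroup E] [NormedSpace ℂ E]
  {A : NonUnitalSubalgebra ℂ (E →L[ℂ] E)} {φ : A → A} {m : ℕ}

/-- Every functional `T ↦ f (T x)` with `f x = 1` is of the form `T ↦ b (φ T a)`, where `b a` is an
`m`-th root of unity. -/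
def PullsBackFunctionals (m : ℕ) (φ : A → A) : Prop :=
  ∀ (x : E) (f : StrongDual ℂ E), f x = 1 → ∃ (a : E) (b : StrongDual ℂ E), b a ^ m = 1 ∧
    ∀ T : A, b ((φ T : E →L[ℂ] E) a) = f ((T : E →L[ℂ] E) x)

theorem exists_ne_zero_apply_eq_zero {K V : Type*} [Field K] [AddCommGroup V] [Module K V]
    {v : Fin 2 → V} (hv : LinearIndependent K v) (p : Module.Dual K V) :
    ∃ w, w ≠ 0 ∧ p w = 0 := by
  by_contra! h
  have hker : LinearMap.ker p = ⊥ := LinearMap.ker_eq_bot'.mpr fun w hw =>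
    by_contra fun hw0 => h w hw0 hw
  simpa using (hv.map' p hker).fintype_card_le_finrank

theorem exists_linearIndependent_pair (hE : 1 < Module.rank ℂ E) :
    ∃ (v : Fin 2 → E) (k : Fin 2 → StrongDual ℂ E),
      LinearIndependent ℂ v ∧ LinearIndependent ℂ k := by
  obtain ⟨v, hv⟩ := Module.le_rank_iff.mp
    (show ((2 : ℕ) : Cardinal) ≤ _ from Cardinal.two_le_iff_one_lt.mpr hE)
  obtain ⟨k, hk⟩ := exists_dual_family hv
  exact ⟨v, k, hv, linearIndependent_of_det_ne_zero
    (fun i => ContinuousLinearMap.apply ℂ ℂ (v i)) (by simp [hk, Matrix.det_fin_two])⟩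

theorem eq_zero_of_apply_eq_zero {D : E →L[ℂ] E}
    (hD : ∀ (x : E) (f : StrongDual ℂ E), f x = 1 → f (D x) = 0) : D = 0 := by
  have h := eq_zero_of_pairing_eq_one (p := ContinuousLinearMap.coeLM ℂ)
    (τ := (ContinuousLinearMap.coeLM ℂ).compl₂ (D : E →ₗ[ℂ] E))
    (fun x hx => SeparatingDual.exists_eq_one hx) fun f x => hD x f
  ext x
  exact SeparatingDual.eq_zero_of_forall_dual_eq_zero (R := ℂ) fun f => LinearMap.congr_fun₂ h f x

theorem apply_eq_apply_of_mul_eq_mul {v a : E} {f b : StrongDual ℂ E}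
    (h : ∀ (g : StrongDual ℂ E) (y : E), g v * f y = g a * b y) (T : E →L[ℂ] E) :
    f (T v) = b (T a) := by
  have hrk : rankOne v f = rankOne a b := by
    ext y
    refine (SeparatingDual.eq_iff_forall_dual_eq (R := ℂ)).mpr fun g => ?_
    simp only [rankOne_apply, map_smul, smul_eq_mul]
    linear_combination h g y
  rw [← finiteRankTrace_rankOne, ← finiteRankTrace_rankOne, ← mul_rankOne, ← mul_rankOne, hrk]

theorem PullsBackFunctionals.eq_add_smul (hφ : PullsBackFunctionals m φ) {T T₁ T₂ : A} {c : ℂ}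
    (h : (φ T : E →L[ℂ] E) = φ T₁ + c • (φ T₂ : E →L[ℂ] E)) :
    (T : E →L[ℂ] E) = T₁ + c • (T₂ : E →L[ℂ] E) := by
  refine sub_eq_zero.mp (eq_zero_of_apply_eq_zero fun x f hxf => ?_)
  obtain ⟨a, b, -, hab⟩ := hφ x f hxf
  simp [← hab, h]

theorem PullsBackFunctionals.exists_preimage_rankOne (hφ : PullsBackFunctionals m φ)
    (hrange : ∀ y g, ∃ C : A, (φ C : E →L[ℂ] E) = rankOne y g) :
    ∃ ψ : E →ₗ[ℂ] StrongDual ℂ E →ₗ[ℂ] E →L[ℂ] E,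
      ∀ y g, ∃ C : A, (φ C : E →L[ℂ] E) = rankOne y g ∧ (C : E →L[ℂ] E) = ψ y g := by
  choose C hC using hrange
  have hadd : ∀ y y' g g' z k (c : ℂ), rankOne z k = rankOne y g + c • rankOne y' g' →
      (C z k : E →L[ℂ] E) = C y g + c • (C y' g' : E →L[ℂ] E) := fun y y' g g' z k c h =>
    hφ.eq_add_smul (by simpa only [hC] using h)
  have hsmul : ∀ y g z k (c : ℂ), rankOne z k = c • rankOne y g →
      (C z k : E →L[ℂ] E) = c • (C y g : E →L[ℂ] E) := fun y g z k c h => by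
    rw [hadd y y g g z k (c - 1) (by rw [h]; module)]
    module
  refine ⟨LinearMap.mk₂ ℂ (fun y g => (C y g : E →L[ℂ] E)) (fun y y' g => ?_) (fun c y g => ?_)
    (fun y g g' => ?_) (fun c y g => ?_), fun y g => ⟨C y g, hC y g, rfl⟩⟩
  · simpa using hadd y y' g g (y + y') g 1 (by simp)
  · exact hsmul y g (c • y) g c (by simp)
  · simpa using hadd y y g g' y (g + g') 1 (by simp)
  · exact hsmul y g y (c • g) c (by simp)

/-- The form `(x, f, g, y) ↦ f (ψ y g x)` attached to a bilinear family of operators `ψ y g`. -/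
noncomputable def pairingForm (ψ : E →ₗ[ℂ] StrongDual ℂ E →ₗ[ℂ] E →L[ℂ] E) :
    E →ₗ[ℂ] StrongDual ℂ E →ₗ[ℂ] StrongDual ℂ E →ₗ[ℂ] E →ₗ[ℂ] ℂ :=
  LinearMap.mk₂ ℂ
    (fun x f => ψ.flip.compr₂ ((f : E →ₗ[ℂ] ℂ) ∘ₗ (ContinuousLinearMap.apply ℂ E x : _ →ₗ[ℂ] E)))
    (fun x x' f => by ext; simp) (fun c x f => by ext; simp)
    (fun x f f' => by ext; simp) (fun c x f => by ext; simp)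

@[simp]
theorem pairingForm_apply (ψ : E →ₗ[ℂ] StrongDual ℂ E →ₗ[ℂ] E →L[ℂ] E) (x : E)
    (f g : StrongDual ℂ E) (y : E) : pairingForm ψ x f g y = f (ψ y g x) := rfl

section Preimage

variable {ψ : E →ₗ[ℂ] StrongDual ℂ E →ₗ[ℂ] E →L[ℂ] E}
  (hψ : ∀ y g, ∃ C : A, (φ C : E →L[ℂ] E) = rankOne y g ∧ (C : E →L[ℂ] E) = ψ y g)
include hψ

theorem pairingForm_eq_mul {x a : E} {f b : StrongDual ℂ E}
    (h : ∀ T : A, b ((φ T : E →L[ℂ] E) a) = f ((T : E →L[ℂ] E) x)) (g : StrongDual ℂ E) (y : E) :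
    pairingForm ψ x f g y = g a * b y := by
  obtain ⟨C, hC, hCψ⟩ := hψ y g
  rw [pairingForm_apply, ← hCψ, ← h, hC, rankOne_apply, map_smul, smul_eq_mul]

theorem isSimple_pairingForm (hφ : PullsBackFunctionals m φ) (x : E) (f : StrongDual ℂ E) :
    IsSimple (pairingForm ψ x f) := by
  have hne : ∀ f : StrongDual ℂ E, f x ≠ 0 → IsSimple (pairingForm ψ x f) := fun f hf => by
    obtain ⟨a, b, -, hab⟩ := hφ x ((f x)⁻¹ • f) (by simp [hf])
    have hs : IsSimple (pairingForm ψ x ((f x)⁻¹ • f)) :=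
      ⟨ContinuousLinearMap.apply ℂ ℂ a, b, pairingForm_eq_mul hψ hab⟩
    simpa [hf] using hs.smul (f x)
  by_cases hf : f x = 0
  · by_cases hx : x = 0
    · exact ⟨0, 0, by simp [hx]⟩
    · obtain ⟨h, hh⟩ := SeparatingDual.exists_eq_one (R := ℂ) hx
      refine (hne h (by simp [hh])).of_add_sub ?_ ?_
      · simpa using hne (f + h) (by simp [hf, hh])
      · simpa using hne (f - h) (by simp [hf, hh])
  · exact hne f hf

theorem eq_of_pairingForm_eq (hA : IsStandard A) (hφ : PullsBackFunctionals m φ) {x : E}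
    {f f' : StrongDual ℂ E} (hf : f x = 1) (hf' : f' x = 1)
    (h : pairingForm ψ x f = pairingForm ψ x f') : f = f' := by
  obtain ⟨a, b, -, hab⟩ := hφ x f hf
  obtain ⟨a', b', -, hab'⟩ := hφ x f' hf'
  have hfA : ∀ C : A, f ((C : E →L[ℂ] E) x) = f' ((C : E →L[ℂ] E) x) := fun C => by
    rw [← hab, ← hab']
    refine apply_eq_apply_of_mul_eq_mul (fun g y => ?_) _
    rw [← pairingForm_eq_mul hψ hab, h, pairingForm_eq_mul hψ hab']
  ext y
  simpa [hf] using hfA ⟨rankOne y f, hA.rankOne_mem y f⟩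

theorem eq_zero_or_of_pairingForm_eq_zero (hA : IsStandard A) (hm : m ≠ 0)
    (hφ : PullsBackFunctionals m φ) {x : E} {f : StrongDual ℂ E} (h0 : pairingForm ψ x f = 0) :
    x = 0 ∨ f = 0 := by
  refine or_iff_not_imp_left.mpr fun hx => ?_
  by_cases hf : f x = 0
  · obtain ⟨h, hh⟩ := SeparatingDual.exists_eq_one (R := ℂ) hx
    simpa using eq_of_pairingForm_eq hψ hA hφ (f := f + h) (by simp [hf, hh]) hh (by simp [h0])
  · obtain ⟨a, b, hba, hab⟩ := hφ x ((f x)⁻¹ • f) (by simp [hf])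
    have h1 := pairingForm_eq_mul hψ hab b a
    rw [map_smul, h0, smul_zero] at h1
    rw [mul_self_eq_zero.mp h1.symm, zero_pow hm] at hba
    exact absurd hba zero_ne_one

theorem exists_pairingForm_ne_zero {g : StrongDual ℂ E} {y : E} (hg : g ≠ 0) (hy : y ≠ 0) :
    ∃ x f, pairingForm ψ x f g y ≠ 0 := by
  have hne : ψ y g ≠ 0 := fun h0 => by
    obtain ⟨C, hC, hCψ⟩ := hψ y g
    obtain ⟨C', hC', hCψ'⟩ := hψ y 0
    obtain rfl : C = C' := Subtype.ext (by rw [hCψ, h0, hCψ', map_zero])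
    obtain ⟨z, hz⟩ := exists_apply_eq_one hg
    have hyg : rankOne y g = 0 := by rw [← hC, hC', map_zero]
    exact hy (by simpa [hz] using DFunLike.congr_fun hyg z)
  obtain ⟨x, hx⟩ := DFunLike.ne_iff.mp hne
  obtain ⟨f, hf⟩ := SeparatingDual.exists_ne_zero (R := ℂ) hx
  exact ⟨x, f, hf⟩

theorem exists_factorization_pairingForm (hA : IsStandard A) (hm : m ≠ 0)
    (hφ : PullsBackFunctionals m φ) (hE : 1 < Module.rank ℂ E) :
    (∃ (S : E →ₗ[ℂ] Module.Dual ℂ (StrongDual ℂ E)) (T : StrongDual ℂ E →ₗ[ℂ] Module.Dual ℂ E),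
      ∀ x f g y, pairingForm ψ x f g y = S x g * T f y) ∨
    ∃ (S : StrongDual ℂ E →ₗ[ℂ] Module.Dual ℂ (StrongDual ℂ E)) (T : E →ₗ[ℂ] Module.Dual ℂ E),
      ∀ x f g y, pairingForm ψ x f g y = S f g * T x y := by
  obtain ⟨v, k, hv, hk⟩ := exists_linearIndependent_pair hE
  refine exists_factorization (isSimple_pairingForm hψ hφ)
    (fun x f => eq_zero_or_of_pairingForm_eq_zero hψ hA hm hφ) (fun p => ?_) fun q => ?_
  · obtain ⟨g, hg, hpg⟩ := exists_ne_zero_apply_eq_zero hk p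
    obtain ⟨x, f, h⟩ := exists_pairingForm_ne_zero hψ hg (hv.ne_zero 0)
    exact ⟨x, f, g, v 0, hpg, h⟩
  · obtain ⟨y, hy, hqy⟩ := exists_ne_zero_apply_eq_zero hv q
    obtain ⟨x, f, h⟩ := exists_pairingForm_ne_zero hψ (hk.ne_zero 0) hy
    exact ⟨x, f, k 0, y, hqy, h⟩

end Preimage

theorem exists_linear_lift {V : Type*} [AddCommGroup V] [Module ℂ V]
    (S : V →ₗ[ℂ] Module.Dual ℂ (StrongDual ℂ E)) (hS : ∀ w, ∃ v, ∀ g, S w g = g v) :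
    ∃ S' : V →ₗ[ℂ] E, ∀ w g, S w g = g (S' w) := by
  choose S' hS' using hS
  have hext : ∀ v v' : E, (∀ g : StrongDual ℂ E, g v = g v') → v = v' := fun _ _ =>
    (SeparatingDual.eq_iff_forall_dual_eq (R := ℂ)).mpr
  exact ⟨⟨⟨S', fun w w' => hext _ _ fun g => by simp [← hS']⟩,
    fun c w => hext _ _ fun g => by simp [← hS']⟩, hS'⟩

theorem exists_evaluation_of_mul_eq {s : Module.Dual ℂ (StrongDual ℂ E)} {t : Module.Dual ℂ E}
    {a : E} {b : StrongDual ℂ E} (hba : b a ≠ 0) (h : ∀ g y, s g * t y = g a * b y) :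
    (∃ v, ∀ g, s g = g v) ∧ ∃ f : StrongDual ℂ E, ∀ y, t y = f y := by
  have hst : s b * t a ≠ 0 := h b a ▸ mul_ne_zero hba hba
  have ht : t a ≠ 0 := right_ne_zero_of_mul hst
  have hs : s b ≠ 0 := left_ne_zero_of_mul hst
  refine ⟨⟨(b a / t a) • a, fun g => ?_⟩, ⟨(b a / s b) • b, fun y => ?_⟩⟩
  · rw [map_smul, smul_eq_mul]
    field_simp
    linear_combination h g a
  · rw [smul_apply, smul_eq_mul]
    field_simp
    linear_combination h b y

section Pairing

variable {V Z : Type*} [NormedAddCommGroup V] [NormedSpace ℂ V] [AddCommGroup Z] [Module ℂ Z]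
  {p : Z →ₗ[ℂ] StrongDual ℂ V} {S : V →ₗ[ℂ] Module.Dual ℂ (StrongDual ℂ E)}
  {T : Z →ₗ[ℂ] Module.Dual ℂ E}

theorem exists_lifts_of_mul_eq (hpV : ∀ w, w ≠ 0 → ∃ z, p z w = 1)
    (hpZ : ∀ z, z ≠ 0 → ∃ w, p z w = 1)
    (h : ∀ z w, p z w = 1 → ∃ (a : E) (b : StrongDual ℂ E), b a ≠ 0 ∧
      ∀ g y, S w g * T z y = g a * b y) :
    (∃ S' : V →ₗ[ℂ] E, ∀ w g, S w g = g (S' w)) ∧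
      ∃ T' : Z → StrongDual ℂ E, ∀ z y, T z y = T' z y := by
  have heval : ∀ z w, p z w = 1 →
      (∃ v, ∀ g, S w g = g v) ∧ ∃ f : StrongDual ℂ E, ∀ y, T z y = f y := fun z w hzw => by
    obtain ⟨a, b, hba, hab⟩ := h z w hzw
    exact exists_evaluation_of_mul_eq hba hab
  constructor
  · refine exists_linear_lift S fun w => ?_
    by_cases hw : w = 0
    · exact ⟨0, by simp [hw]⟩
    · obtain ⟨z, hz⟩ := hpV w hw
      exact (heval z w hz).1
  · refine Classical.skolem (p := fun z (f : StrongDual ℂ E) => ∀ y, T z y = f y).mp fun z => ?_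
    by_cases hz : z = 0
    · exact ⟨0, by simp [hz]⟩
    · obtain ⟨w, hw⟩ := hpZ z hz
      exact (heval z w hw).2

/-- For `p = ⟨·,·⟩` on `E' × E` this yields the automorphisms, and for `p = ⟨·,·⟩` on `E × E'` the
antiautomorphisms. -/
theorem exists_intertwiner_of_factorization [CompleteSpace E] [CompleteSpace V] [Nontrivial V]
    (hm : m ≠ 0) (hrange : ∀ y g, ∃ C : A, (φ C : E →L[ℂ] E) = rankOne y g)
    (α : A → V →L[ℂ] V) (hpV : ∀ w, w ≠ 0 → ∃ z, p z w = 1)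
    (hpZ : ∀ z, z ≠ 0 → ∃ w, p z w = 1) (hT : ∀ y, (∀ z, T z y = 0) → y = 0)
    (h : ∀ z w, p z w = 1 → ∃ (a : E) (b : StrongDual ℂ E), b a ^ m = 1 ∧
      (∀ g y, S w g * T z y = g a * b y) ∧
      ∀ C, b ((φ C : E →L[ℂ] E) a) = p z (α C w)) :
    ∃ c : ℂ, c ^ m = 1 ∧ ∃ R : V ≃L[ℂ] E, ∀ C,
      (φ C : E →L[ℂ] E) = c • ((R : V →L[ℂ] E) ∘L α C ∘L (R.symm : E →L[ℂ] V)) := by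
  obtain ⟨⟨S', hS'⟩, T', hT'⟩ := exists_lifts_of_mul_eq hpV hpZ fun z w hzw => by
    obtain ⟨a, b, hba, hab, -⟩ := h z w hzw
    exact ⟨a, b, fun h0 => by simp [h0, hm] at hba, hab⟩
  have hone : ∀ z w, p z w = 1 → T z (S' w) ^ m = 1 ∧
      ∀ C, T z ((φ C : E →L[ℂ] E) (S' w)) = p z (α C w) := fun z w hzw => by
    obtain ⟨a, b, hba, hab, hC⟩ := h z w hzw
    have htr := apply_eq_apply_of_mul_eq_mul (v := S' w) (f := T' z) fun g y => by
      rw [← hab, hS', hT']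
    simp only [hT']
    exact ⟨by simpa [hba] using congrArg (· ^ m) (htr 1), fun C => (htr _).trans (hC C)⟩
  let pair : Z →ₗ[ℂ] V →ₗ[ℂ] ℂ := (ContinuousLinearMap.coeLM ℂ) ∘ₗ p
  obtain ⟨c, hcm, hc⟩ := exists_eq_mul_pairing (p := pair) (τ := T.compl₂ S') hm hpV
    fun z w hzw => (hone z w hzw).1
  have hC0 : ∀ C, T.compl₂ ((φ C : E →ₗ[ℂ] E) ∘ₗ S') - pair.compl₂ (α C : V →ₗ[ℂ] V) = 0 :=
    fun C => eq_zero_of_pairing_eq_one (p := pair) hpV fun z w hzw =>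
      sub_eq_zero.mpr ((hone z w hzw).2 C)
  have hC : ∀ C z w, T z ((φ C : E →L[ℂ] E) (S' w)) = p z (α C w) := fun C z w =>
    sub_eq_zero.mp (LinearMap.congr_fun₂ (hC0 C) z w)
  have hc0 : c ≠ 0 := by rintro rfl; simp [hm] at hcm
  refine ⟨c⁻¹, by rw [inv_pow, hcm, inv_one], exists_intertwiner
    (fun C : A => (φ C : E →L[ℂ] E)) hrange α (fun z => p z) (fun w hw => ?_) S'
    (fun z => c⁻¹ • T' z) (fun y hy => hT y fun z => ?_) (fun z w => ?_) fun C z w => ?_⟩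
  · by_contra hw0
    obtain ⟨z, hz⟩ := hpV w hw0
    simp [hw] at hz
  · simpa [← hT', hc0] using hy z
  · rw [smul_apply, ← hT', smul_eq_mul]
    exact (inv_mul_eq_iff_eq_mul₀ hc0).mpr (hc z w)
  · rw [smul_apply, ← hT', hC, smul_eq_mul]

end Pairing

theorem exists_eq_smul_of_rank_le_one (hE : Module.rank ℂ E ≤ 1) (T : E →L[ℂ] E) :
    ∃ t : ℂ, T = t • 1 := by
  obtain ⟨v, hv⟩ := rank_le_one_iff.mp hE
  obtain ⟨t, ht⟩ := hv (T v)
  refine ⟨t, ?_⟩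
  ext y
  obtain ⟨r, rfl⟩ := hv y
  simp [← ht, smul_comm r t]

theorem hasStandardForm_of_rank_le_one (hE : Module.rank ℂ E ≤ 1) (hm : m ≠ 0)
    (hφ : PullsBackFunctionals m φ) : HasStandardForm m φ := by
  rcases subsingleton_or_nontrivial E with _ | _
  · exact ⟨1, one_pow m, .inl ⟨.refl ℂ E, fun T => Subsingleton.elim _ _⟩⟩
  obtain ⟨x, hx⟩ := exists_ne (0 : E)
  obtain ⟨f, hf⟩ := SeparatingDual.exists_eq_one (R := ℂ) hx
  obtain ⟨a, b, hba, hab⟩ := hφ x f hf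
  have hba0 : b a ≠ 0 := fun h0 => by simp [h0, hm] at hba
  refine ⟨(b a)⁻¹, by rw [inv_pow, hba, inv_one], .inl ⟨.refl ℂ E, fun T => ?_⟩⟩
  obtain ⟨s, hs⟩ := exists_eq_smul_of_rank_le_one hE (φ T : E →L[ℂ] E)
  obtain ⟨t, ht⟩ := exists_eq_smul_of_rank_le_one hE (T : E →L[ℂ] E)
  have hst : s * b a = t := by simpa [hs, ht, hf] using hab T
  ext y
  simp [hs, ht, ← hst, hba0, smul_smul, mul_comm s]

theorem hasStandardForm_of_pullsBackFunctionals [CompleteSpace E] (hA : IsStandard A)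
    (hm : m ≠ 0) (hrange : ∀ y g, ∃ C : A, (φ C : E →L[ℂ] E) = rankOne y g)
    (hφ : PullsBackFunctionals m φ) : HasStandardForm m φ := by
  rcases le_or_gt (Module.rank ℂ E) 1 with hE | hE
  · exact hasStandardForm_of_rank_le_one hE hm hφ
  obtain ⟨v, k, hv, hk⟩ := exists_linearIndependent_pair hE
  have : Nontrivial E := ⟨v 0, 0, hv.ne_zero 0⟩
  have : Nontrivial (StrongDual ℂ E) := ⟨k 0, 0, hk.ne_zero 0⟩
  obtain ⟨ψ, hψ⟩ := hφ.exists_preimage_rankOne hrange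
  have hmul : ∀ x f, f x = 1 → ∃ (a : E) (b : StrongDual ℂ E), b a ^ m = 1 ∧
      (∀ g y, pairingForm ψ x f g y = g a * b y) ∧
      ∀ C : A, b ((φ C : E →L[ℂ] E) a) = f ((C : E →L[ℂ] E) x) := fun x f hf => by
    obtain ⟨a, b, hba, hab⟩ := hφ x f hf
    exact ⟨a, b, hba, pairingForm_eq_mul hψ hab, hab⟩
  have hsep : ∀ y, (∀ x f g, pairingForm ψ x f g y = 0) → y = 0 := fun y hy => by
    by_contra hy0
    obtain ⟨x, f, h⟩ := exists_pairingForm_ne_zero hψ (hk.ne_zero 0) hy0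
    exact h (hy x f _)
  rcases exists_factorization_pairingForm hψ hA hm hφ hE with ⟨S, T, hF⟩ | ⟨S, T, hF⟩ <;>
    simp only [hF] at hmul hsep
  · obtain ⟨c, hc, R, hR⟩ := exists_intertwiner_of_factorization (p := LinearMap.id) hm hrange
      (fun C => (C : E →L[ℂ] E)) (fun x hx => SeparatingDual.exists_eq_one hx)
      (fun f hf => exists_apply_eq_one hf) (fun y hy => hsep y fun x f g => by simp [hy])
      fun f x hfx => hmul x f hfx
    exact ⟨c, hc, .inl ⟨R, hR⟩⟩
  · obtain ⟨c, hc, R, hR⟩ := exists_intertwiner_of_factorization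
      (p := (ContinuousLinearMap.apply ℂ ℂ : E →L[ℂ] _).toLinearMap) hm hrange
      (fun C => dualOp (C : E →L[ℂ] E)) (fun f hf => exists_apply_eq_one hf)
      (fun x hx => SeparatingDual.exists_eq_one hx) (fun y hy => hsep y fun x f g => by simp [hy])
      hmul
    exact ⟨c, hc, .inr ⟨R, hR⟩⟩

end Functionals

section Jordan

variable {E : Type*} [NormedAddCommGroup E] [NormedSpace ℂ E]
  {A : NonUnitalSubalgebra ℂ (E →L[ℂ] E)} {θ : A ≃ₗ[ℂ] A}

theorem IsAlgAut.isJordanAut (h : IsAlgAut θ) : IsJordanAut θ := fun x y => by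
  rw [map_add, h, h]

theorem IsJordanAut.map_mul_self (h : IsJordanAut θ) (x : A) : θ (x * x) = θ x * θ x := by
  have hxx := h x x
  rw [← two_smul ℂ, ← two_smul ℂ (θ x * θ x), map_smul] at hxx
  exact smul_right_injective _ (two_ne_zero (α := ℂ)) hxx

theorem IsJordanAut.map_mul_mul (h : IsJordanAut θ) (x y : A) :
    θ (x * y * x) = θ x * θ y * θ x := by
  have key : ∀ x y : A, (x * y + y * x) * x + x * (x * y + y * x) =
      (2 : ℂ) • (x * y * x) + ((x * x) * y + y * (x * x)) := fun x y => by
    rw [two_smul]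
    simp only [add_mul, mul_add, mul_assoc]
    abel
  have hxy := h (x * y + y * x) x
  rw [key, map_add, map_smul, h (x * x) y, h, h.map_mul_self, key] at hxy
  exact smul_right_injective _ (two_ne_zero (α := ℂ)) (add_right_cancel hxy)

theorem rankLE_one_of_mul_rankOne_mul {T : E →L[ℂ] E}
    (h : ∀ y g, ∃ c : ℂ, T * rankOne y g * T = c • T) : RankLE 1 T := by
  refine rankLE_iff_not_linearIndependent.mpr fun v hv => ?_
  obtain ⟨g, hg⟩ := exists_dual_family hv
  obtain ⟨c, hc⟩ := h (v 1) (g 0)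
  simpa [hg] using congrArg (g 1) (DFunLike.congr_fun hc (v 0))

theorem IsJordanAut.map_rankOne (h : IsJordanAut θ) (hA : IsStandard A) (x : E)
    (f : StrongDual ℂ E) : ∃ x' f',
      (θ ⟨rankOne x f, hA.rankOne_mem x f⟩ : E →L[ℂ] E) = rankOne x' f' ∧ f' x' = f x := by
  set a : A := ⟨rankOne x f, hA.rankOne_mem x f⟩ with ha
  have hrank : RankLE 1 (θ a : E →L[ℂ] E) := rankLE_one_of_mul_rankOne_mul fun y g => by
    obtain ⟨b, hb⟩ := θ.surjective ⟨rankOne y g, hA.rankOne_mem y g⟩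
    have haba : a * b * a = f ((b : E →L[ℂ] E) x) • a := Subtype.ext (by simp [ha])
    have := congrArg θ haba
    rw [h.map_mul_mul, map_smul, hb] at this
    exact ⟨_, congrArg Subtype.val this⟩
  obtain ⟨x', f', hθ⟩ := hrank.exists_rankOne
  refine ⟨x', f', hθ, ?_⟩
  by_cases h0 : a = 0
  · have hxf : rankOne x f = 0 := congrArg Subtype.val h0
    rw [← finiteRankTrace_rankOne, ← finiteRankTrace_rankOne, ← hθ, h0, map_zero, hxf]
    rfl
  · have haa : a * a = f x • a := Subtype.ext (by simp [ha])
    have hθaa : θ a * θ a = f' x' • θ a := Subtype.ext (by simp [hθ])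
    have hsmul : f' x' • θ a = f x • θ a := by rw [← hθaa, ← h.map_mul_self, haa, map_smul]
    exact smul_left_injective ℂ (θ.map_ne_zero_iff.mpr h0) hsmul

/-- The operator `N` is the image of `M ∈ A` under some Jordan automorphism of `A`. -/
def IsJordanImage (A : NonUnitalSubalgebra ℂ (E →L[ℂ] E)) (M N : E →L[ℂ] E) : Prop :=
  ∃ θ : A ≃ₗ[ℂ] A, IsJordanAut θ ∧ ∃ a : A, (a : E →L[ℂ] E) = M ∧ (θ a : E →L[ℂ] E) = N

theorem IsJordanImage.exists_sum_rankOne {M N : E →L[ℂ] E} (h : IsJordanImage A M N)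
    (hA : IsStandard A) {d : ℕ} (hM : RankLE d M) :
    ∃ n ≤ d, ∃ (x x' : Fin n → E) (f f' : Fin n → StrongDual ℂ E),
      M = ∑ i, rankOne (x i) (f i) ∧ N = ∑ i, rankOne (x' i) (f' i) ∧
        ∀ i, f' i (x' i) = f i (x i) := by
  obtain ⟨θ, hθ, a, rfl, rfl⟩ := h
  have := hM.finiteDimensional_range
  obtain ⟨x, f, ha⟩ := exists_eq_sum_rankOne (a : E →L[ℂ] E)
  choose x' f' hx' htr using fun i => hθ.map_rankOne hA (x i) (f i)
  refine ⟨_, hM.finrank_le, x, x', f, f', ha, ?_, htr⟩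
  have hsum : a = ∑ i, (⟨rankOne (x i) (f i), hA.rankOne_mem _ _⟩ : A) :=
    Subtype.ext (ha.trans (by simp))
  exact (congrArg (fun b => (θ b : E →L[ℂ] E)) hsum).trans (by simp [map_sum, hx'])

theorem IsJordanImage.rankLE {M N : E →L[ℂ] E} (h : IsJordanImage A M N) (hA : IsStandard A)
    {d : ℕ} (hM : RankLE d M) : RankLE d N := by
  obtain ⟨n, hn, x, x', f, f', -, rfl, -⟩ := h.exists_sum_rankOne hA hM
  exact RankLE.mono (by simpa using rankLE_sum_rankOne Finset.univ x' f') hn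

theorem IsJordanImage.finiteRankTrace_eq {M N : E →L[ℂ] E} (h : IsJordanImage A M N)
    (hA : IsStandard A) {d : ℕ} (hM : RankLE d M) :
    finiteRankTrace (M : E →ₗ[ℂ] E) = finiteRankTrace (N : E →ₗ[ℂ] E) := by
  obtain ⟨n, -, x, x', f, f', rfl, rfl, htr⟩ := h.exists_sum_rankOne hA hM
  simp only [finiteRankTrace_sum_rankOne, htr]

end Jordan

theorem smul_add_pow {R M : Type*} [CommSemiring R] [Semiring M] [Algebra R M] {Q N : M}
    (hQ : IsIdempotentElem Q) (hQN : Q * N = 0) (hNQ : N * Q = 0) (c : R) {n : ℕ} (hn : n ≠ 0) :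
    (c • Q + N) ^ n = c ^ n • Q + N ^ n := by
  obtain ⟨k, rfl⟩ := Nat.exists_eq_succ_of_ne_zero hn
  induction k with
  | zero => simp
  | succ k ih =>
    have hpow : N ^ (k + 1) * Q = 0 := by rw [pow_succ, mul_assoc, hNQ, mul_zero]
    rw [pow_succ, ih k.succ_ne_zero]
    simp only [add_mul, mul_add, smul_mul_assoc, mul_smul_comm, hQ.eq, hQN, hpow, smul_zero,
      add_zero, zero_add, smul_smul, ← pow_succ, ← pow_succ', Nat.succ_eq_add_one]

section RootsOfRankOne

variable {E : Type*} [NormedAddCommGroup E] [NormedSpace ℂ E] {T N : E →L[ℂ] E} {u : E}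
  {v : StrongDual ℂ E} {c : ℂ}

theorem isIdempotentElem_rankOne (hvu : v u = 1) : IsIdempotentElem (rankOne u v) := by
  rw [IsIdempotentElem, rankOne_mul_rankOne, hvu, one_smul]

theorem rankOne_pow (hvu : v u = 1) {n : ℕ} (hn : n ≠ 0) : rankOne u v ^ n = rankOne u v := by
  obtain ⟨k, rfl⟩ := Nat.exists_eq_succ_of_ne_zero hn
  exact (isIdempotentElem_rankOne hvu).pow_succ_eq k

theorem apply_eq_zero_of_mul_rankOne (hvu : v u = 1) (hNQ : N * rankOne u v = 0) : N u = 0 := by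
  simpa [hvu] using DFunLike.congr_fun hNQ u

theorem apply_eq_zero_of_rankOne_mul (hvu : v u = 1) (hQN : rankOne u v * N = 0) (y : E) :
    v (N y) = 0 := by
  simpa [hvu] using congrArg v (DFunLike.congr_fun hQN y)

theorem exists_smul_rankOne_add_of_pow_eq_rankOne {m : ℕ} (hm : m ≠ 0) (hvu : v u = 1)
    (hT : T ^ m = rankOne u v) : ∃ (c : ℂ) (N : E →L[ℂ] E), c ^ m = 1 ∧
      T = c • rankOne u v + N ∧ rankOne u v * N = 0 ∧ N * rankOne u v = 0 ∧ N ^ m = 0 := by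
  set Q := rankOne u v with hQ
  have hQQ : Q * Q = Q := isIdempotentElem_rankOne hvu
  have hcomm : T * Q = Q * T := by rw [← hT, ← pow_succ, ← pow_succ']
  have hQT : Q * T = v (T u) • Q := by
    calc Q * T = Q * (T * Q) := by rw [hcomm, ← mul_assoc, hQQ]
      _ = v (T u) • Q := by rw [hQ, mul_rankOne, rankOne_mul_rankOne]
  obtain ⟨N, hN⟩ : ∃ N, T = v (T u) • Q + N := ⟨T - v (T u) • Q, by abel⟩
  have hQN : Q * N = 0 := by
    rwa [hN, mul_add, mul_smul_comm, hQQ, ← hN, add_eq_left] at hQT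
  have hNQ : N * Q = 0 := by
    rw [← hcomm, hN, add_mul, smul_mul_assoc, hQQ, ← hN, add_eq_left] at hQT
    exact hQT
  have hpow : v (T u) ^ m • Q + N ^ m = Q := by
    rw [← smul_add_pow hQQ hQN hNQ _ hm, ← hN, hT]
  have hc : v (T u) ^ m = 1 := by
    have hNu : (N ^ m) u = 0 := by
      rw [← Nat.sub_add_cancel (Nat.one_le_iff_ne_zero.mpr hm), pow_succ, mul_apply_eq_comp,
        apply_eq_zero_of_mul_rankOne hvu hNQ, map_zero]
    simpa [hQ, hvu, hNu] using congrArg v (DFunLike.congr_fun hpow u)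
  rw [hc, one_smul, add_eq_left] at hpow
  exact ⟨_, N, hc, hN, hQN, hNQ, hpow⟩

theorem RankLE.of_smul_rankOne_add {d : ℕ} (h : RankLE (d + 1) (c • rankOne u v + N))
    (hvu : v u = 1) (hc : c ≠ 0) (hQN : rankOne u v * N = 0) (hNQ : N * rankOne u v = 0) :
    RankLE d N := by
  refine rankLE_iff_not_linearIndependent.mpr fun w hw => ?_
  have hNu := apply_eq_zero_of_mul_rankOne hvu hNQ
  have hvN := apply_eq_zero_of_rankOne_mul hvu hQN
  refine rankLE_iff_not_linearIndependent.mp h (Fin.cons u fun i => w i - v (w i) • u) ?_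
  have himage : (fun i => (c • rankOne u v + N)
      ((Fin.cons u fun i => w i - v (w i) • u : Fin (d + 2) → E) i)) =
      Fin.cons (c • u) fun i => N (w i) := by
    ext i
    induction i using Fin.cases with
    | zero => simp [hvu, hNu]
    | succ i => simp [hvu, hNu]
  rw [himage]
  refine linearIndependent_finCons.mpr ⟨hw, fun hmem => ?_⟩
  have hker : Submodule.span ℂ (Set.range fun i => N (w i)) ≤
      LinearMap.ker (v : E →ₗ[ℂ] ℂ) := by
    rw [Submodule.span_le]
    rintro _ ⟨i, rfl⟩
    exact hvN (w i)
  have hvcu : v (c • u) = 0 := hker hmem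
  simp [hvu, hc] at hvcu

theorem RankLE.mul_self_eq_zero (h : RankLE 1 N) {m : ℕ} (hm : N ^ m = 0) : N * N = 0 := by
  obtain ⟨w, z, rfl⟩ := h.exists_rankOne
  have hpow : ∀ k : ℕ, rankOne w z ^ (k + 1) = z w ^ k • rankOne w z := by
    intro k
    induction k with
    | zero => simp
    | succ k ih => rw [pow_succ, ih, smul_mul_assoc, rankOne_mul_rankOne, smul_smul, ← pow_succ]
  have hzw : z w ^ m • rankOne w z = 0 := by rw [← hpow, pow_succ, hm, zero_mul]
  rw [rankOne_mul_rankOne]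
  rcases smul_eq_zero.mp hzw with hzw | hwz
  · rw [eq_zero_of_pow_eq_zero hzw, zero_smul]
  · rw [hwz, smul_zero]

/-- If `N = rankOne w z ≠ 0`, choose `e` and `p` dual to `z` and `w`: the Jordan product with
`rankOne u v + rankOne e p` is then independent on `u`, `e`, `w`. -/
theorem eq_zero_of_rankLE_two_jordan (hvu : v u = 1) (hc : c ≠ 0) (hQN : rankOne u v * N = 0)
    (hNQ : N * rankOne u v = 0) (hN1 : RankLE 1 N) (hNN : N * N = 0)
    (h : ∀ R : E →L[ℂ] E, RankLE 2 R →
      RankLE 2 ((c • rankOne u v + N) * R + R * (c • rankOne u v + N))) : N = 0 := by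
  have hNu := apply_eq_zero_of_mul_rankOne hvu hNQ
  have hvN := apply_eq_zero_of_rankOne_mul hvu hQN
  obtain ⟨w, z, rfl⟩ := hN1.exists_rankOne
  by_contra hne
  have hw : w ≠ 0 := by rintro rfl; simp at hne
  have hz : z ≠ 0 := by rintro rfl; simp at hne
  have hzu : z u = 0 := by simpa [hw] using hNu
  obtain ⟨y, hy⟩ := exists_apply_eq_one hz
  have hvw : v w = 0 := by simpa [hy] using hvN y
  have hzw : z w = 0 := by
    rw [rankOne_mul_rankOne] at hNN
    exact (smul_eq_zero.mp hNN).resolve_right hne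
  obtain ⟨e, hze, hve⟩ : ∃ e, z e = 1 ∧ v e = 0 :=
    ⟨y - v y • u, by simp [hy, hzu], by simp [hvu]⟩
  obtain ⟨k, hk⟩ := SeparatingDual.exists_eq_one (R := ℂ) hw
  obtain ⟨p, hpw, hpu, hpe⟩ : ∃ p : StrongDual ℂ E, p w = 1 ∧ p u = 0 ∧ p e = 0 :=
    ⟨k - k u • v - k e • z, by simp [hk, hvw, hzw], by simp [hvu, hzu], by simp [hve, hze]⟩
  refine rankLE_iff_not_linearIndependent.mp
    (h (rankOne u v + rankOne e p) ((rankLE_rankOne _ _).add (rankLE_rankOne _ _))) ![u, e, w]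
    (linearIndependent_of_det_ne_zero ![v, z, p] ?_)
  rw [Matrix.det_fin_three]
  simp [hvu, hve, hvw, hzu, hze, hzw, hpw, hpu, hpe, hc]

end RootsOfRankOne

section Sandwich

variable {E : Type*} [NormedAddCommGroup E] [NormedSpace ℂ E] {n r s d : ℕ} {B X : E →L[ℂ] E}

theorem RankLE.pow (h : RankLE d B) (hn : n ≠ 0) : RankLE d (B ^ n) := by
  obtain ⟨k, rfl⟩ := Nat.exists_eq_succ_of_ne_zero hn
  rw [pow_succ]
  exact h.mul_left _

theorem rankLE_pow_mul_mul_pow (hrs : r + s ≠ 0) (h : RankLE d B ∨ RankLE d X) :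
    RankLE d (B ^ r * X * B ^ s) := by
  rcases h with hB | hX
  · by_cases hs : s = 0
    · exact ((hB.pow (by lia)).mul_right _).mul_right _
    · exact (hB.pow hs).mul_left _
  · exact (hX.mul_left _).mul_right _

theorem finiteRankTrace_pow_mul_mul_pow (hB : RankLE d B) (X : E →L[ℂ] E) :
    finiteRankTrace (B ^ r * X * B ^ s : E →L[ℂ] E).toLinearMap =
      finiteRankTrace (B ^ (r + s) * X : E →L[ℂ] E).toLinearMap := by
  by_cases hs : s = 0
  · simp [hs]
  · have := (hB.pow hs).finiteDimensional_range
    rw [add_comm, pow_add, mul_assoc (B ^ s)]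
    exact finiteRankTrace_mul_comm _ _

/-- The word `B ^ r * X * B ^ s` in two letters (`n = 0`) and its Jordan version (`n = 1`), treated
at once. -/
noncomputable def sandwich (n r s : ℕ) (B X : E →L[ℂ] E) : E →L[ℂ] E :=
  B ^ r * X * B ^ s + n • (B ^ s * X * B ^ r)

theorem sandwich_self : sandwich n r s B B = (n + 1) • B ^ (r + s + 1) := by
  have hpow : ∀ r s : ℕ, B ^ r * B * B ^ s = B ^ (r + s + 1) := fun r s => by
    rw [← pow_succ, ← pow_add, add_right_comm]
  rw [sandwich, hpow, hpow, add_comm s r, succ_nsmul']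

theorem rankLE_sandwich (hrs : r + s ≠ 0) (h : RankLE d B ∨ RankLE d X) :
    RankLE ((n + 1) * d) (sandwich n r s B X) := by
  have hsr : RankLE d (B ^ s * X * B ^ r) := rankLE_pow_mul_mul_pow (by lia) h
  rw [sandwich, add_mul, one_mul, add_comm (n * d)]
  refine (rankLE_pow_mul_mul_pow hrs h).add ?_
  rcases n.eq_zero_or_pos with rfl | hn
  · simp [RankLE]
  · rw [← Nat.cast_smul_eq_nsmul ℂ]
    exact (hsr.smul n).mono (Nat.le_mul_of_pos_left d hn)

theorem finiteRankTrace_sandwich (hrs : r + s ≠ 0) (hB : RankLE d B) (X : E →L[ℂ] E) :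
    finiteRankTrace (sandwich n r s B X : E →ₗ[ℂ] E) =
      (n + 1) * finiteRankTrace (B ^ (r + s) * X : E →L[ℂ] E).toLinearMap := by
  have hfin : ∀ {r s : ℕ}, r + s ≠ 0 →
      FiniteDimensional ℂ (LinearMap.range (B ^ r * X * B ^ s : E →L[ℂ] E).toLinearMap) :=
    fun h => (rankLE_pow_mul_mul_pow h (Or.inl hB)).finiteDimensional_range
  have := hfin hrs
  have := hfin (add_comm r s ▸ hrs)
  have : FiniteDimensional ℂ (LinearMap.range
      ((n : ℂ) • (B ^ s * X * B ^ r : E →L[ℂ] E).toLinearMap)) :=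
    ((rankLE_pow_mul_mul_pow (add_comm r s ▸ hrs) (Or.inl hB)).smul n).finiteDimensional_range
  rw [sandwich, ← Nat.cast_smul_eq_nsmul ℂ, ContinuousLinearMap.toLinearMap_add,
    ContinuousLinearMap.toLinearMap_smul, finiteRankTrace_add, finiteRankTrace_smul,
    finiteRankTrace_pow_mul_mul_pow hB, finiteRankTrace_pow_mul_mul_pow hB, add_comm s r]
  ring

theorem mul_sandwich_mul {R : E →L[ℂ] E} (hR : IsIdempotentElem R) :
    R * sandwich n r s R X * R = (n + 1) • (R * X * R) := by
  have hpow : ∀ r s : ℕ, R * (R ^ r * X * R ^ s) * R = R * X * R := fun r s => by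
    calc R * (R ^ r * X * R ^ s) * R = R ^ (r + 1) * X * R ^ (s + 1) := by
          rw [pow_succ', pow_succ]; simp only [mul_assoc]
      _ = R * X * R := by rw [hR.pow_succ_eq, hR.pow_succ_eq]
  rw [sandwich, mul_add, add_mul, mul_smul_comm, smul_mul_assoc, hpow, hpow, succ_nsmul']

theorem rankLE_of_sandwich (h : ∀ R : E →L[ℂ] E, RankLE (d + 1) R → RankLE d (sandwich n r s R X)) :
    RankLE d X := by
  refine rankLE_of_compression fun R hRR hR => ?_
  have hcomp := (((h R hR).mul_left R).mul_right R).smul ((n + 1 : ℕ) : ℂ)⁻¹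
  rwa [mul_sandwich_mul hRR, ← Nat.cast_smul_eq_nsmul ℂ,
    inv_smul_smul₀ (Nat.cast_ne_zero.mpr n.succ_ne_zero)] at hcomp

end Sandwich

section PreservesSandwich

variable {E : Type*} [NormedAddCommGroup E] [NormedSpace ℂ E]
  {A : NonUnitalSubalgebra ℂ (E →L[ℂ] E)} {n r s : ℕ} {φ : A → A}

/-- The local hypothesis of the theorem, restricted to two of the variables: `sandwich n r s` is
preserved up to a Jordan automorphism, which may depend on the arguments. -/
def PreservesSandwich (n r s : ℕ) (φ : A → A) : Prop :=
  ∀ B X : A, RankLE 1 (B : E →L[ℂ] E) ∨ RankLE 1 (X : E →L[ℂ] E) →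
    IsJordanImage A (sandwich n r s B X) (sandwich n r s (φ B) (φ X))

variable (hφ : PreservesSandwich n r s φ) (hA : IsStandard A) {B X : A}
include hφ hA

theorem PreservesSandwich.exists_pow_eq_rankOne {x : E} {f : StrongDual ℂ E} (hf : f x = 1)
    (hB : (B : E →L[ℂ] E) = rankOne x f) :
    ∃ u v, v u = 1 ∧ (φ B : E →L[ℂ] E) ^ (r + s + 1) = rankOne u v := by
  have hB1 : RankLE 1 (B : E →L[ℂ] E) := hB ▸ rankLE_rankOne x f
  have hn : (n + 1 : ℂ) ≠ 0 := n.cast_add_one_ne_zero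
  have hBB : sandwich n r s (B : E →L[ℂ] E) B = rankOne ((n + 1 : ℂ) • x) f := by
    rw [sandwich_self, hB, rankOne_pow hf (Nat.succ_ne_zero _), ← Nat.cast_smul_eq_nsmul ℂ]
    simp
  have himage := hφ B B (Or.inl hB1)
  rw [hBB] at himage
  obtain ⟨u, v, huv⟩ := (himage.rankLE hA (rankLE_rankOne _ _)).exists_rankOne
  have hvu := himage.finiteRankTrace_eq hA (rankLE_rankOne _ _)
  rw [huv, finiteRankTrace_rankOne, finiteRankTrace_rankOne, map_smul, hf, smul_eq_mul,
    mul_one] at hvu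
  refine ⟨(n + 1 : ℂ)⁻¹ • u, v, by simp [← hvu, hn], ?_⟩
  rw [sandwich_self, ← Nat.cast_smul_eq_nsmul ℂ, Nat.cast_succ] at huv
  rw [map_smul, smul_apply, ← huv, inv_smul_smul₀ hn]

variable (hrs : r + s ≠ 0)
include hrs

theorem PreservesSandwich.rankLE (h : RankLE 1 (B : E →L[ℂ] E) ∨ RankLE 1 (X : E →L[ℂ] E)) :
    RankLE (n + 1) (sandwich n r s (φ B) (φ X) : E →L[ℂ] E) :=
  (hφ B X h).rankLE hA (by simpa using rankLE_sandwich (n := n) hrs h)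

theorem PreservesSandwich.finiteRankTrace_eq (hB : RankLE 1 (B : E →L[ℂ] E)) :
    finiteRankTrace (sandwich n r s (B : E →L[ℂ] E) X).toLinearMap =
      finiteRankTrace (sandwich n r s (φ B : E →L[ℂ] E) (φ X)).toLinearMap :=
  (hφ B X (Or.inl hB)).finiteRankTrace_eq hA (rankLE_sandwich hrs (Or.inl hB))

variable (hrange : ∀ R : E →L[ℂ] E, RankLE (n + 2) R → ∃ C : A, (φ C : E →L[ℂ] E) = R)
include hrange

theorem PreservesSandwich.rankLE_apply (hB : RankLE 1 (B : E →L[ℂ] E)) :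
    RankLE (n + 1) (φ B : E →L[ℂ] E) := by
  refine rankLE_of_sandwich (n := n) (r := r) (s := s) fun R hR => ?_
  obtain ⟨C, rfl⟩ := hrange R hR
  exact hφ.rankLE hA hrs (Or.inr hB)

theorem PreservesSandwich.pow_eq_zero (hn : n ≤ 1) (hB : RankLE 1 (B : E →L[ℂ] E)) {u : E}
    {v : StrongDual ℂ E} {c : ℂ} {N : E →L[ℂ] E} (hvu : v u = 1) (hc : c ≠ 0)
    (hφB : (φ B : E →L[ℂ] E) = c • rankOne u v + N) (hQN : rankOne u v * N = 0)
    (hNQ : N * rankOne u v = 0) (hN : N ^ (r + s + 1) = 0) : N ^ (r + s) = 0 := by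
  have hrank : RankLE n N :=
    (hφB ▸ hφ.rankLE_apply hA hrs hrange hB).of_smul_rankOne_add hvu hc hQN hNQ
  obtain rfl | rfl : n = 0 ∨ n = 1 := by lia
  · rw [hrank.eq_zero, zero_pow hrs]
  have hNN : N * N = 0 := hrank.mul_self_eq_zero hN
  by_cases hrs1 : r + s = 1
  · rw [hrs1, pow_one]
    refine eq_zero_of_rankLE_two_jordan hvu hc hQN hNQ hrank hNN fun R hR => ?_
    obtain ⟨C, rfl⟩ := hrange R (hR.mono (by lia))
    have hBC := hφ.rankLE hA hrs (X := C) (Or.inl hB)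
    rw [hφB] at hBC
    obtain ⟨rfl, rfl⟩ | ⟨rfl, rfl⟩ : (r = 0 ∧ s = 1) ∨ (r = 1 ∧ s = 0) := by lia
    · simpa [sandwich, add_comm] using hBC
    · simpa [sandwich] using hBC
  · rw [← Nat.sub_add_cancel (show 2 ≤ r + s by lia), pow_add, pow_two, hNN, mul_zero]

theorem PreservesSandwich.pullsBackFunctionals (hn : n ≤ 1) :
    PullsBackFunctionals (r + s + 1) φ := by
  intro x f hf
  let B : A := ⟨rankOne x f, hA.rankOne_mem x f⟩
  have hB1 : RankLE 1 (B : E →L[ℂ] E) := rankLE_rankOne x f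
  obtain ⟨u, v, hvu, hpow⟩ := hφ.exists_pow_eq_rankOne hA (B := B) hf rfl
  obtain ⟨c, N, hcm, hφB, hQN, hNQ, hN⟩ :=
    exists_smul_rankOne_add_of_pow_eq_rankOne (Nat.succ_ne_zero _) hvu hpow
  have hc : c ≠ 0 := by rintro rfl; simp at hcm
  have hφpow : (φ B : E →L[ℂ] E) ^ (r + s) = c ^ (r + s) • rankOne u v := by
    rw [hφB, smul_add_pow (isIdempotentElem_rankOne hvu) hQN hNQ c hrs,
      hφ.pow_eq_zero hA hrs hrange hn hB1 hvu hc hφB hQN hNQ hN, add_zero]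
  refine ⟨c ^ (r + s) • u, v, ?_, fun Y => ?_⟩
  · rw [map_smul, hvu, smul_eq_mul, mul_one, ← pow_mul, mul_comm, pow_mul, hcm, one_pow]
  · have htrace := hφ.finiteRankTrace_eq hA hrs (X := Y) hB1
    rw [finiteRankTrace_sandwich hrs hB1,
      finiteRankTrace_sandwich hrs (hφ.rankLE_apply hA hrs hrange hB1), hφpow,
      rankOne_pow hf hrs, smul_mul_assoc, rankOne_mul, rankOne_mul, ← smul_apply, ← map_smul,
      finiteRankTrace_rankOne, finiteRankTrace_rankOne] at htrace
    simpa using (mul_left_cancel₀ n.cast_add_one_ne_zero htrace).symm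

end PreservesSandwich

section Words

theorem prod_ofFn_ite {M : Type*} [Monoid M] (X B : M) : ∀ {m : ℕ} (p : Fin m),
    (List.ofFn fun j => if j = p then X else B).prod = B ^ (p : ℕ) * X * B ^ (m - 1 - p)
  | 0, p => p.elim0
  | m + 1, p => by
    rw [List.ofFn_succ, List.prod_cons]
    induction p using Fin.cases with
    | zero => simp [Fin.succ_ne_zero]
    | succ p =>
      have hexp : m + 1 - 1 - ((p : ℕ) + 1) = m - 1 - p := by lia
      simp only [Fin.succ_inj, prod_ofFn_ite X B p, hexp, Fin.val_succ, pow_succ',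
        (Fin.succ_ne_zero p).symm, if_false, mul_assoc]

variable {E : Type*} [NormedAddCommGroup E] [NormedSpace ℂ E]
  {A : NonUnitalSubalgebra ℂ (E →L[ℂ] E)} {m k : ℕ}

theorem IndexSeq.one_lt (s : IndexSeq m k) : 1 < m := by
  have hcard := Fintype.card_le_of_surjective _ s.surj
  simp only [Fintype.card_fin] at hcard
  exact s.two_le.trans hcard

/-- The arguments of a generalized product that are `X` at the index `i` and `B` elsewhere. -/
def twoVar (i : Fin k) (B X : A) : Fin k → A := fun j => if j = i then X else B

theorem exists_rankLE_twoVar {d : ℕ} (hk : 2 ≤ k) (i : Fin k) {B X : A}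
    (h : RankLE d (B : E →L[ℂ] E) ∨ RankLE d (X : E →L[ℂ] E)) :
    ∃ j, RankLE d (twoVar i B X j : E →L[ℂ] E) := by
  rcases h with hB | hX
  · have : Nontrivial (Fin k) := Fin.nontrivial_iff_two_le.mpr hk
    obtain ⟨j, hj⟩ := exists_ne i
    exact ⟨j, by simpa [twoVar, hj] using hB⟩
  · exact ⟨i, by simpa [twoVar] using hX⟩

variable (s : IndexSeq m k) {p : Fin m} (hp : ∀ q, q ≠ p → s.idx q ≠ s.idx p) (B X : A)
include hp

theorem coe_wordProd_twoVar (σ : Equiv.Perm (Fin m)) :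
    (wordProd s.pos (fun j => twoVar (s.idx p) B X (s.idx (σ j))) : E →L[ℂ] E) =
      (B : E →L[ℂ] E) ^ (σ.symm p : ℕ) * X * (B : E →L[ℂ] E) ^ (m - 1 - (σ.symm p : ℕ)) := by
  rw [← prod_ofFn_ite]
  refine congrArg (fun T => (List.ofFn T).prod) (funext fun j => ?_)
  have hj : s.idx (σ j) = s.idx p ↔ j = σ.symm p := by
    rw [Equiv.eq_symm_apply]
    exact ⟨fun h => by_contra fun hne => hp _ hne h, fun h => by rw [h]⟩
  simp only [twoVar, apply_ite Subtype.val, hj]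

theorem coe_genProd_twoVar :
    (genProd s (twoVar (s.idx p) B X) : E →L[ℂ] E) = sandwich 0 p (m - 1 - p) B X := by
  rw [sandwich, zero_smul, add_zero]
  exact coe_wordProd_twoVar s hp B X 1

theorem coe_genJordanProd_twoVar :
    (genJordanProd s (twoVar (s.idx p) B X) : E →L[ℂ] E) = sandwich 1 p (m - 1 - p) B X := by
  have hrev := coe_wordProd_twoVar s hp B X Fin.revPerm
  have hp_rev : ((Fin.revPerm.symm p : Fin m) : ℕ) = m - 1 - p := by
    rw [Fin.revPerm_symm, Fin.revPerm_apply, Fin.val_rev]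
    lia
  rw [hp_rev, show m - 1 - (m - 1 - (p : ℕ)) = p by lia] at hrev
  rw [sandwich, one_smul]
  exact congrArg₂ (· + ·) (coe_wordProd_twoVar s hp B X 1) hrev

end Words

theorem hasStandardForm_of_preservesSandwich {E : Type*} [NormedAddCommGroup E] [NormedSpace ℂ E]
    [CompleteSpace E] {A : NonUnitalSubalgebra ℂ (E →L[ℂ] E)} (hA : IsStandard A) {n r s : ℕ}
    {φ : A → A} (hn : n ≤ 1) (hrs : r + s ≠ 0) (hφ : PreservesSandwich n r s φ)
    (hrange : ∀ T : A, RankLE (n + 2) (T : E →L[ℂ] E) → T ∈ Set.range φ) :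
    HasStandardForm (r + s + 1) φ := by
  have hrange' (R : E →L[ℂ] E) (hR : RankLE (n + 2) R) : ∃ C : A, (φ C : E →L[ℂ] E) = R := by
    obtain ⟨C, hC⟩ := hrange ⟨R, hA.mem_of_rankLE hR⟩ hR
    exact ⟨C, congrArg Subtype.val hC⟩
  exact hasStandardForm_of_pullsBackFunctionals hA (Nat.succ_ne_zero _)
    (fun y g => hrange' _ ((rankLE_rankOne y g).mono (by lia)))
    (hφ.pullsBackFunctionals hA hrs hrange' hn)

theorem hasStandardForm_of_local {E : Type*} [NormedAddCommGroup E] [NormedSpace ℂ E]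
    [CompleteSpace E] {A : NonUnitalSubalgebra ℂ (E →L[ℂ] E)} (hA : IsStandard A) {m k n : ℕ}
    (s : IndexSeq m k) {φ : A → A} (hn : n ≤ 1)
    (hrange : ∀ T : A, RankLE (n + 2) (T : E →L[ℂ] E) → T ∈ Set.range φ) (P : (Fin k → A) → A)
    (hP : ∀ p : Fin m, (∀ q, q ≠ p → s.idx q ≠ s.idx p) → ∀ B X : A,
      (P (twoVar (s.idx p) B X) : E →L[ℂ] E) = sandwich n p (m - 1 - p) B X)
    (h : ∀ a : Fin k → A, (∃ j, RankLE 1 (a j : E →L[ℂ] E)) →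
      ∃ θ : A ≃ₗ[ℂ] A, IsJordanAut θ ∧ P (fun j => φ (a j)) = θ (P a)) :
    HasStandardForm m φ := by
  obtain ⟨p, hp⟩ := s.exists_single
  have hm := s.one_lt
  have hφ : PreservesSandwich n p (m - 1 - p) φ := fun B X hBX => by
    obtain ⟨θ, hθ, hPθ⟩ := h _ (exists_rankLE_twoVar s.two_le (s.idx p) hBX)
    refine ⟨θ, hθ, _, hP p hp B X, ?_⟩
    have htwoVar : (fun j => φ (twoVar (s.idx p) B X j)) = twoVar (s.idx p) (φ B) (φ X) :=
      funext fun j => apply_ite φ _ _ _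
    rw [← hPθ, htwoVar, hP p hp]
  have hpm : (p : ℕ) + (m - 1 - p) + 1 = m := by lia
  exact hpm ▸ hasStandardForm_of_preservesSandwich hA hn (by lia) hφ hrange

end OpProd

theorem theorem2p4 {E : Type*} [NormedAddCommGroup E] [NormedSpace ℂ E] [CompleteSpace E]
    (A : NonUnitalSubalgebra ℂ (E →L[ℂ] E)) (hA : OpProd.IsStandard A)
    {m k : ℕ} (s : OpProd.IndexSeq m k) (φ : A → A) :
    ((∀ T : A, OpProd.RankLE 2 (T : E →L[ℂ] E) → T ∈ Set.range φ) →
      (∀ a : Fin k → A, (∃ j, OpProd.RankLE 1 (a j : E →L[ℂ] E)) →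
        ∃ θ : A ≃ₗ[ℂ] A, OpProd.IsAlgAut θ ∧
          OpProd.genProd s (fun j => φ (a j)) = θ (OpProd.genProd s a)) →
      OpProd.HasStandardForm m φ) ∧
    ((∀ T : A, OpProd.RankLE 3 (T : E →L[ℂ] E) → T ∈ Set.range φ) →
      (∀ a : Fin k → A, (∃ j, OpProd.RankLE 1 (a j : E →L[ℂ] E)) →
        ∃ θ : A ≃ₗ[ℂ] A, OpProd.IsJordanAut θ ∧
          OpProd.genJordanProd s (fun j => φ (a j)) = θ (OpProd.genJordanProd s a)) →
      OpProd.HasStandardForm m φ) := by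
  refine ⟨fun hrange h => ?_, fun hrange h => ?_⟩
  · refine OpProd.hasStandardForm_of_local hA s zero_le_one hrange (OpProd.genProd s)
      (fun p hp => OpProd.coe_genProd_twoVar s hp) fun a ha => ?_
    obtain ⟨θ, hθ, hθa⟩ := h a ha
    exact ⟨θ, hθ.isJordanAut, hθa⟩
  · exact OpProd.hasStandardForm_of_local hA s le_rfl hrange (OpProd.genJordanProd s)
      (fun p hp => OpProd.coe_genJordanProd_twoVar s hp) h
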